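/- **Cohomology functors.** Let $G$ be a topological group, $\Sigma\subseteq G$ a submonoid, $A$ a commutative ring. A *cohomology functor* $M$ for $(G,\Sigma)$ assigns to each open compact subgroup $U\subseteq\Sigma$ an $A$-module $M(U)$, to each $g\in\Sigma^{-1}$ with $g^{-1}Ug\subseteq V$ a map $[g]_{\star}=[g]_{U,V,\star}:M(U)\to M(V)$ and to each $g\in\Sigma$ with $g^{-1}Ug\subseteq V$ a map $[g]^{\star}:M(V)\to M(U)$. These depend only on $UgV$, are (covariantly, resp. contravariantly) functorial for $[h]\circ[g]=[gh]$, and satisfy $[g]^\star_{U,V}=[g^{-1}]_{V,U,\star}$ whenever $g^{-1}Ug=V$ and $g\in\Sigma$. Write $\mathrm{pr}=[1]$. $M$ is *Cartesian* if for all $U,U'\subseteq V$ $$\mathrm{pr}_{U,V}^\star\circ\mathrm{pr}_{U',V,\star}=\sum_{\gamma\in U\backslash V/U'}\mathrm{pr}_{U_\gamma,U,\star}\circ[\gamma]^\star_{U_\gamma,U'},\qquad U_\gamma=\gamma U'\gamma^{-1}\cap U .$$ For a subgroup $K$ put $M_{\mathrm{Iw}}(K)=\varprojlim_{U\supseteq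 K}M(U)$ (limit under $\mathrm{pr}_\star$, over open compact $U\subseteq\Sigma$). If $M$ is Cartesian, $K$ is contained in some open compact subgroup in $\Sigma$ and $K'\subseteq K$ is open in $K$, there is a unique map $\mathrm{pr}^\star:M_{\mathrm{Iw}}(K)\to M_{\mathrm{Iw}}(K')$ which on components is $\mathrm{pr}^\star_{V',V}$ for all $V\supseteq V'$ with $K\subseteq V$, $V'\cap K=K'$, $V=V'K$. If $H\subseteq G$ is a closed subgroup and $M_H,M_G$ are Cartesian cohomology functors for $(H,\Sigma\cap H)$ and $(G,\Sigma)$, a *pushforward map* $\iota_\star:M_H\to M_G$ is a family of maps $\iota_{U,\star}:M_H(U\cap H)\to M_G(U)$ commuting with $[h]_\star$ for $h\in H\cap\Sigma^{-1}$ and such that for $U\subseteq V$ $$\mathrm{pr}_{U,V}^\star\circ\iota_{V,\star}=\sum_{\gamma\in U\backslash V/(V\cap H)}[\gamma^{-1}]_{\star}\circ\iota_{\gamma^{-1}U\gamma,\star}\circ\mathrm{pr}^\star_{\gamma^{-1}U\gamma\cap H,\,V\cap H}.$$ **Setting.** Let $p$ be a prime, $G$ a smooth affine group scheme over $\mathbf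 Z_p$, $Q_H^0\subseteq H\subseteq G$ closed subgroup schemes, and $\eta:\mathbf G_m\to G$ a cocharacter. Let $Q_G,\bar Q_G$ be the subgroups of those $g$ for which $\lim_{t\to0}\eta(t)g\eta(t)^{-1}$, resp. $\lim_{t\to0}\eta(t)^{-1}g\eta(t)$, exists, let $N_G,\bar N_G$ be the subgroups where this limit is $1$, and let $L_G$ be the centraliser of $\eta$. (If $H\subseteq G$ are reductive and $Q_H^0$ is a mirabolic subgroup of $H$, this says that $Q_G=L_GN_G$ is a parabolic subgroup of $G$, $\bar Q_G=L_G\bar N_G$ is its opposite, and $\eta$ is a strictly dominant cocharacter of the centre of $L_G$.) Let $L_G^0\subseteq L_G$ be a closed normal subgroup scheme, $\bar Q_G^0=\bar N_GL_G^0$, and let $u\in G(\mathbf Z_p)$ be such that: (A) the $Q_H^0$-orbit of $u$ in $G/\bar Q_G$ is open, in the scheme-theoretic sense that the orbit map $Q_H^0\to G/\bar Q_G$, $q\mapsto qu$, is smooth (equivalently, $Q_H^0\times\bar Q_G\to G$, $(q,b)\mapsto qub$, is smooth); (B) $u^{-1}Q_H^0u\cap\bar Q_G\subseteq\bar Q_G^0$.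 Put $\tau=\eta(p)\in G(\mathbf Q_p)$ and, for $r\ge1$, $$U_r=\{g\in G(\mathbf Z_p):\tau^{-r}g\tau^r\in G(\mathbf Z_p),\ g\bmod p^r\in\bar Q_G^0(\mathbf Z/p^r)\},\qquad V_r=\tau^{-r}U_r\tau^r .$$ Let $\Sigma\subseteq G(\mathbf Q_p)$ be a submonoid containing $G(\mathbf Z_p)$ and $\tau^{-1}$, let $M_G$, $M_H$ be Cartesian cohomology functors for $(G(\mathbf Q_p),\Sigma)$ and $(H(\mathbf Q_p),\Sigma\cap H(\mathbf Q_p))$ with coefficients in a commutative ring $A$, and let $\iota_\star:M_H\to M_G$ be a pushforward map. For $U=U_r$ or $V_r$ let $\mathcal T=[\tau]_\star\circ\mathrm{pr}^\star:M_G(U)\to M_G(U\cap\tau U\tau^{-1})\to M_G(U)$ be the Hecke operator of the double coset $U\tau^{-1}U$. For $z_H\in M_{H,\mathrm{Iw}}(Q_H^0(\mathbf Z_p))$ let $z_{G,r}\in M_G(U_r)$ be the image of $z_H$ under $$M_{H,\mathrm{Iw}}(Q_H^0(\mathbf Z_p))\xrightarrow{\mathrm{pr}^\star}M_{H,\mathrm{Iw}}(Q_H^0(\mathbf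 Z_p)\cap uU_ru^{-1})\to M_H(H(\mathbf Q_p)\cap uU_ru^{-1})\xrightarrow{\iota_\star}M_G(uU_ru^{-1})\xrightarrow{[u]_\star}M_G(U_r),$$ where the second map is the projection, and put $\xi_{G,r}=[\tau^r]_{U_r,V_r,\star}(z_{G,r})\in M_G(V_r)$. **Proposition.** For every $r\ge1$ one has $\tau^{-1}U_{r+1}\tau\subseteq U_r$ and $V_{r+1}\subseteq V_r$, and $$[\tau]_{U_{r+1},U_r,\star}(z_{G,r+1})=\mathcal T\cdot z_{G,r}\ \text{ in } M_G(U_r),\qquad \mathrm{pr}_{V_{r+1},V_r,\star}(\xi_{G,r+1})=\mathcal T\cdot\xi_{G,r}\ \text{ in } M_G(V_r).$$ -/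

import Mathlib

open scoped TensorProduct LaurentPolynomial Polynomial

noncomputable section

namespace NormRelations

universe v v' w

section Formalism

variable {G : Type*} [Group G]

/-- The conjugate subgroup `g⁻¹ U g`. -/
def conjSubgroup (g : G) (U : Subgroup G) : Subgroup G :=
  U.comap (MulAut.conj g).toMonoidHom

theorem mem_conjSubgroup {g x : G} {U : Subgroup G} :
    x ∈ conjSubgroup g U ↔ g * x * g⁻¹ ∈ U := Iff.rfl

/-- The condition `g⁻¹ U g ⊆ V`. -/
def IsArrow (g : G) (U V : Subgroup G) : Prop := ∀ x ∈ U, g⁻¹ * x * g ∈ V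

theorem isArrow_one {U V : Subgroup G} (h : U ≤ V) : IsArrow (1 : G) U V := by
  intro x hx
  simpa using h hx

theorem IsArrow.mul {g h : G} {U V W : Subgroup G} (hg : IsArrow g U V) (hh : IsArrow h V W) :
    IsArrow (g * h) U W := by
  intro x hx
  have := hh _ (hg x hx)
  simpa [mul_assoc] using this

theorem isArrow_conj (g : G) (U : Subgroup G) : IsArrow g U (conjSubgroup g U) := by
  intro x hx
  rw [mem_conjSubgroup]
  simpa [mul_assoc] using hx

theorem isArrow_conj_inv (g : G) (U : Subgroup G) : IsArrow g⁻¹ (conjSubgroup g U) U := by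
  intro x hx
  rw [mem_conjSubgroup] at hx
  simpa using hx

theorem conjSubgroup_le {U V : Subgroup G} (hUV : U ≤ V) {γ : G} (hγ : γ ∈ V) :
    conjSubgroup γ U ≤ V := by
  intro x hx
  have := V.mul_mem (V.mul_mem (V.inv_mem hγ) (hUV (mem_conjSubgroup.1 hx))) hγ
  simpa [mul_assoc] using this

theorem isArrow_conj_inv_left (g : G) (U : Subgroup G) : IsArrow g (conjSubgroup g⁻¹ U) U := by
  simpa using isArrow_conj_inv g⁻¹ U

theorem isArrow_inter (g : G) (U V : Subgroup G) : IsArrow g (U ⊓ conjSubgroup g⁻¹ V) V := by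
  intro x hx
  have := mem_conjSubgroup.1 hx.2
  simpa using this

/-- `T` is a set of representatives for the double cosets `U \ V / W`. -/
def IsDoubleCosetReps (T : Finset G) (V U W : Subgroup G) : Prop :=
  (∀ γ ∈ T, γ ∈ V) ∧ ∀ v ∈ V, ∃! γ, γ ∈ T ∧ ∃ a ∈ U, ∃ b ∈ W, v = a * γ * b

/-- An open compact subgroup contained in the monoid `S`. -/
@[ext]
structure LevelGroup [TopologicalSpace G] (S : Submonoid G) where
  /-- the underlying subgroup -/
  grp : Subgroup G
  isOpen : IsOpen (grp : Set G)
  isCompact : IsCompact (grp : Set G)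
  subset : ∀ g ∈ grp, g ∈ S

section Topology

variable [TopologicalSpace G] [IsTopologicalGroup G]

theorem conjSubgroup_isOpen (g : G) {U : Subgroup G} (hU : IsOpen (U : Set G)) :
    IsOpen (conjSubgroup g U : Set G) :=
  hU.preimage (f := fun x : G => g * x * g⁻¹) (by fun_prop)

theorem conjSubgroup_isCompact (g : G) {U : Subgroup G} (hU : IsCompact (U : Set G)) :
    IsCompact (conjSubgroup g U : Set G) := by
  have : (conjSubgroup g U : Set G) = (fun x : G => g⁻¹ * x * g) '' (U : Set G) := by
    ext x
    constructor
    · intro hx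
      exact ⟨g * x * g⁻¹, hx, by simp [mul_assoc]⟩
    · rintro ⟨y, hy, rfl⟩
      exact isArrow_conj g U y hy
  rw [this]
  exact hU.image (by fun_prop)

theorem isCompact_of_isOpen_le {U V : Subgroup G} (hU : IsOpen (U : Set G)) (h : U ≤ V)
    (hV : IsCompact (V : Set G)) : IsCompact (U : Set G) :=
  hV.of_isClosed_subset (U.isClosed_of_isOpen hU) h

variable {S : Submonoid G}

/-- An open subgroup of a level group, as a level group. -/
def LevelGroup.ofLE (V : LevelGroup S) (U : Subgroup G) (hU : IsOpen (U : Set G))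
    (h : U ≤ V.grp) : LevelGroup S where
  grp := U
  isOpen := hU
  isCompact := isCompact_of_isOpen_le hU h V.isCompact
  subset g hg := V.subset g (h hg)

/-- The level group `g⁻¹ U g`, when it is contained in `S`. -/
def LevelGroup.conj (U : LevelGroup S) (g : G) (h : ∀ x ∈ conjSubgroup g U.grp, x ∈ S) :
    LevelGroup S where
  grp := conjSubgroup g U.grp
  isOpen := conjSubgroup_isOpen g U.isOpen
  isCompact := conjSubgroup_isCompact g U.isCompact
  subset := h

/-- The level group `U ∩ g V g⁻¹`. -/
def LevelGroup.interConj (U V : LevelGroup S) (g : G) : LevelGroup S :=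
  U.ofLE (U.grp ⊓ conjSubgroup g⁻¹ V.grp)
    (U.isOpen.inter (conjSubgroup_isOpen g⁻¹ V.isOpen)) inf_le_left

/-- The level group `U ∩ H` of the closed subgroup `H`. -/
def LevelGroup.restrict (U : LevelGroup S) (H : Subgroup G) (hH : IsClosed (H : Set G)) :
    LevelGroup (S.comap H.subtype) where
  grp := U.grp.comap H.subtype
  isOpen := U.isOpen.preimage continuous_subtype_val
  isCompact := hH.isClosedEmbedding_subtypeVal.isCompact_preimage U.isCompact
  subset g hg := U.subset g hg

end Topology

variable [TopologicalSpace G]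

/-- A cohomology functor for `(G, S)` with coefficients in `A`: a covariant functor `push` for the
arrows `[g] : U ⟶ V` (`g⁻¹ U g ⊆ V`) with `g ∈ S⁻¹` and a contravariant functor `pull` for the
arrows with `g ∈ S`, with the same values on objects. Arrows only depend on the double coset
`U g V`; the composite of `[g] : U ⟶ V` and `[h] : V ⟶ W` is `[g * h] : U ⟶ W`. -/
structure CohomologyFunctor (A : Type w) [CommRing A] (S : Submonoid G) where
  /-- the modules `M(U)` -/
  obj : LevelGroup S → Type v
  [addCommGroup : ∀ U, AddCommGroup (obj U)]
  [module : ∀ U, Module A (obj U)]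
  /-- the pushforward `[g]_⋆ : M(U) → M(V)` -/
  push : ∀ {U V : LevelGroup S} (g : G), g⁻¹ ∈ S → IsArrow g U.grp V.grp → (obj U →ₗ[A] obj V)
  /-- the pullback `[g]^⋆ : M(V) → M(U)` -/
  pull : ∀ {U V : LevelGroup S} (g : G), g ∈ S → IsArrow g U.grp V.grp → (obj V →ₗ[A] obj U)
  push_congr : ∀ {U V : LevelGroup S} (g g' : G) (hg hg' h h'),
    (∃ a ∈ U.grp, ∃ b ∈ V.grp, g' = a * g * b) →
      (push g hg h : obj U →ₗ[A] obj V) = push g' hg' h'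
  pull_congr : ∀ {U V : LevelGroup S} (g g' : G) (hg hg' h h'),
    (∃ a ∈ U.grp, ∃ b ∈ V.grp, g' = a * g * b) →
      (pull g hg h : obj V →ₗ[A] obj U) = pull g' hg' h'
  push_one : ∀ {U : LevelGroup S} (h1 h),
    (push (1 : G) h1 h : obj U →ₗ[A] obj U) = LinearMap.id
  pull_one : ∀ {U : LevelGroup S} (h1 h),
    (pull (1 : G) h1 h : obj U →ₗ[A] obj U) = LinearMap.id
  push_mul : ∀ {U V W : LevelGroup S} (g k : G) (hg hk hgk h h' h''),
    (push (g * k) hgk h'' : obj U →ₗ[A] obj W) =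
      (push k hk h' : obj V →ₗ[A] obj W) ∘ₗ (push g hg h : obj U →ₗ[A] obj V)
  pull_mul : ∀ {U V W : LevelGroup S} (g k : G) (hg hk hgk h h' h''),
    (pull (g * k) hgk h'' : obj W →ₗ[A] obj U) =
      (pull g hg h : obj V →ₗ[A] obj U) ∘ₗ (pull k hk h' : obj W →ₗ[A] obj V)
  /-- `[g]_{U,V}^⋆ = [g⁻¹]_{V,U,⋆}` whenever `g⁻¹ U g = V` -/
  pull_eq_push : ∀ {U V : LevelGroup S} (g : G) (hg hg' h h'),
    (pull g hg h : obj V →ₗ[A] obj U) = push g⁻¹ hg' h'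

attribute [instance] CohomologyFunctor.addCommGroup CohomologyFunctor.module

namespace CohomologyFunctor

variable {A : Type w} [CommRing A] {S : Submonoid G} (M : CohomologyFunctor.{v} A S)

/-- The pushforward `pr_⋆` along an inclusion `U ⊆ V`. -/
def prPush {U V : LevelGroup S} (h : U.grp ≤ V.grp) : M.obj U →ₗ[A] M.obj V :=
  M.push 1 (by simp) (isArrow_one h)

/-- The pullback `pr^⋆` along an inclusion `U ⊆ V`. -/
def prPull {U V : LevelGroup S} (h : U.grp ≤ V.grp) : M.obj V →ₗ[A] M.obj U :=
  M.pull 1 (by simp) (isArrow_one h)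

theorem prPush_self {U : LevelGroup S} (h : U.grp ≤ U.grp) (x : M.obj U) : M.prPush h x = x := by
  simp [prPush, M.push_one]

theorem prPush_prPush {U V W : LevelGroup S} (h : U.grp ≤ V.grp) (h' : V.grp ≤ W.grp)
    (x : M.obj U) : M.prPush h' (M.prPush h x) = M.prPush (h.trans h') x := by
  have := M.push_mul (U := U) (V := V) (W := W) 1 1 (by simp) (by simp) (by simp)
    (isArrow_one h) (isArrow_one h') ((isArrow_one h).mul (isArrow_one h'))
  have h2 := LinearMap.congr_fun this x
  simp only [mul_one, LinearMap.comp_apply] at h2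
  exact h2.symm

/-- The Iwasawa completion: the inverse limit of `M(U)` under the maps `pr_⋆`, over the level
groups `U` containing `K`. -/
def iw (K : Subgroup G) : Submodule A (∀ U : {U : LevelGroup S // K ≤ U.grp}, M.obj U.1) where
  carrier := {x | ∀ (U V : {U : LevelGroup S // K ≤ U.grp}) (h : U.1.grp ≤ V.1.grp),
    M.prPush h (x U) = x V}
  add_mem' := by
    intro x y hx hy U V h
    simp [hx U V h, hy U V h]
  zero_mem' := by
    intro U V h
    simp
  smul_mem' := by
    intro c x hx U V h
    simp [hx U V h]

variable [IsTopologicalGroup G]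

/-- The Cartesian property: for `U, U' ⊆ V`, the composite of `pr_⋆ : M(U') → M(V)` and
`pr^⋆ : M(V) → M(U)` is the sum over `γ ∈ U \ V / U'` of the maps
`[γ]^⋆ : M(U') → M(U_γ)` and `pr_⋆ : M(U_γ) → M(U)`, where `U_γ = γ U' γ⁻¹ ∩ U`. -/
def IsCartesian : Prop :=
  ∀ (V U U' : LevelGroup S) (hU : U.grp ≤ V.grp) (hU' : U'.grp ≤ V.grp) (T : Finset G)
    (hT : IsDoubleCosetReps T V.grp U.grp U'.grp) (x : M.obj U'),
    M.prPull hU (M.prPush hU' x) =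
      ∑ γ : T, M.prPush (U := U.interConj U' γ) (V := U) inf_le_left
        (M.pull (γ : G) (V.subset _ (hT.1 γ γ.2)) (isArrow_inter _ _ _) x)

/-- The Hecke operator attached to the double coset `U g⁻¹ U`: the composite of
`pr^⋆ : M(U) → M(U')` and `[g]_⋆ : M(U') → M(U)`, where `U' = U ∩ g U g⁻¹`. -/
def hecke (g : G) (hg : g⁻¹ ∈ S) (U : LevelGroup S) : M.obj U →ₗ[A] M.obj U :=
  M.push (U := U.interConj U g) g hg (isArrow_inter _ _ _) ∘ₗ M.prPull inf_le_left

end CohomologyFunctor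

end Formalism

section FinitePullback

variable {G : Type*} [Group G] [TopologicalSpace G] [IsTopologicalGroup G]

/-- A pair of levels `V' ⊆ V` containing `K'` and `K` respectively, with `V' ∩ K = K'` and such
that `K / K' → V / V'` is bijective (so `[V : V'] = [K : K']`). -/
structure IsGoodPair (K K' V V' : Subgroup G) : Prop where
  le : K ≤ V
  le' : K' ≤ V'
  le_pair : V' ≤ V
  inf_le : V' ⊓ K ≤ K'
  exists_mul : ∀ v ∈ V, ∃ a ∈ V', ∃ b ∈ K, v = a * b

variable {S : Submonoid G}

theorem exists_isGoodPair {K K' : Subgroup G} (hKK' : K' ≤ K)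
    (hK' : ∃ W : Subgroup G, IsOpen (W : Set G) ∧ W ⊓ K ≤ K')
    (V₀ U' : LevelGroup S) (hV₀ : K ≤ V₀.grp) (hU' : K' ≤ U'.grp) :
    ∃ V V' : LevelGroup S, IsGoodPair K K' V.grp V'.grp ∧ V.grp ≤ V₀.grp ∧ V'.grp ≤ U'.grp := by
  obtain ⟨W, hWo, hWK⟩ := hK'
  have : CompactSpace V₀.grp := isCompact_iff_compactSpace.1 V₀.isCompact
  -- an open subgroup of `V₀`, contained in `U'` and `W`
  let N₀ : Subgroup V₀.grp := (U'.grp ⊓ W).comap V₀.grp.subtype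
  have hN₀ : IsOpen (N₀ : Set V₀.grp) := (U'.isOpen.inter hWo).preimage continuous_subtype_val
  have hquot : Finite (V₀.grp ⧸ N₀) := Subgroup.quotient_finite_of_isOpen N₀ hN₀
  have hfin : N₀.FiniteIndex := Subgroup.finiteIndex_of_finite_quotient
  have hNc : IsClosed (N₀.normalCore : Set V₀.grp) :=
    N₀.normalCore_isClosed (N₀.isClosed_of_isOpen hN₀)
  have hNo : IsOpen (N₀.normalCore : Set V₀.grp) :=
    N₀.normalCore.isOpen_of_isClosed_of_finiteIndex hNc
  let N : Subgroup G := N₀.normalCore.map V₀.grp.subtype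
  have hN : IsOpen (N : Set G) := V₀.isOpen.isOpenEmbedding_subtypeVal.isOpenMap _ hNo
  have hNV : N ≤ V₀.grp := by
    rintro _ ⟨y, -, rfl⟩
    exact y.2
  have hNU : N ≤ U'.grp ⊓ W := by
    rintro _ ⟨y, hy, rfl⟩
    exact N₀.normalCore_le hy
  have hnorm : ∀ k ∈ V₀.grp, ∀ n ∈ N, k * n * k⁻¹ ∈ N := by
    rintro k hk _ ⟨y, hy, rfl⟩
    exact ⟨⟨k, hk⟩ * y * ⟨k, hk⟩⁻¹,
      (inferInstance : N₀.normalCore.Normal).conj_mem y hy ⟨k, hk⟩, rfl⟩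
  -- the product subgroups `N K` and `N K'`
  let P : ∀ L : Subgroup G, L ≤ V₀.grp → Subgroup G := fun L hL =>
    { carrier := {x | ∃ n ∈ N, ∃ k ∈ L, x = n * k}
      mul_mem' := by
        rintro _ _ ⟨n, hn, k, hk, rfl⟩ ⟨n', hn', k', hk', rfl⟩
        exact ⟨n * (k * n' * k⁻¹), N.mul_mem hn (hnorm k (hL hk) n' hn'), k * k',
          L.mul_mem hk hk', by group⟩
      one_mem' := ⟨1, N.one_mem, 1, L.one_mem, by simp⟩
      inv_mem' := by
        rintro _ ⟨n, hn, k, hk, rfl⟩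
        exact ⟨k⁻¹ * n⁻¹ * k⁻¹⁻¹, hnorm _ (V₀.grp.inv_mem (hL hk)) _ (N.inv_mem hn), k⁻¹,
          L.inv_mem hk, by group⟩ }
  have hNP : ∀ L hL, N ≤ P L hL := fun L hL n hn => ⟨n, hn, 1, L.one_mem, by simp⟩
  have hLP : ∀ L hL, L ≤ P L hL := fun L hL k hk => ⟨1, N.one_mem, k, hk, by simp⟩
  have hPV : ∀ L hL, P L hL ≤ V₀.grp := by
    rintro L hL _ ⟨n, hn, k, hk, rfl⟩
    exact V₀.grp.mul_mem (hNV hn) (hL hk)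
  have hPo : ∀ L hL, IsOpen (P L hL : Set G) := fun L hL =>
    Subgroup.isOpen_mono (hNP L hL) hN
  have hL' : K' ≤ V₀.grp := hKK'.trans hV₀
  refine ⟨V₀.ofLE (P K hV₀) (hPo K hV₀) (hPV K hV₀), V₀.ofLE (P K' hL') (hPo K' hL') (hPV K' hL'),
    ⟨hLP K hV₀, hLP K' hL', ?_, ?_, ?_⟩, hPV K hV₀, ?_⟩
  · rintro _ ⟨n, hn, k, hk, rfl⟩
    exact ⟨n, hn, k, hKK' hk, rfl⟩
  · rintro x ⟨⟨n, hn, k, hk, rfl⟩, hxK⟩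
    have hnK : n ∈ K := by
      have := K.mul_mem hxK (K.inv_mem (hKK' hk))
      simpa using this
    exact K'.mul_mem (hWK ⟨(hNU hn).2, hnK⟩) hk
  · rintro _ ⟨n, hn, k, hk, rfl⟩
    exact ⟨n, hNP K' hL' hn, k, hk, rfl⟩
  · rintro _ ⟨n, hn, k, hk, rfl⟩
    exact U'.grp.mul_mem (hNU hn).1 (hU' hk)

variable {A : Type w} [CommRing A] (M : CohomologyFunctor.{v} A S)

theorem goodPair_compat (hM : M.IsCartesian) {K K' : Subgroup G}
    {V V' V₁ V₁' : LevelGroup S} (h : IsGoodPair K K' V.grp V'.grp)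
    (h₁ : IsGoodPair K K' V₁.grp V₁'.grp) (hV : V₁.grp ≤ V.grp) (hV' : V₁'.grp ≤ V'.grp)
    (x : M.obj V₁) :
    M.prPull h.le_pair (M.prPush hV x) = M.prPush hV' (M.prPull h₁.le_pair x) := by
  have hT : IsDoubleCosetReps {(1 : G)} V.grp V'.grp V₁.grp := by
    refine ⟨by simp, fun v hv => ⟨1, ⟨by simp, ?_⟩, fun γ hγ => by simpa using hγ.1⟩⟩
    obtain ⟨a, ha, b, hb, rfl⟩ := h.exists_mul v hv
    exact ⟨a, ha, b, h₁.le hb, by simp⟩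
  rw [hM V V' V₁ h.le_pair hV {1} hT x, Fintype.sum_subsingleton _ ⟨1, by simp⟩]
  have hEq : V₁' = V'.interConj V₁ 1 := by
    have : V₁'.grp = (V'.interConj V₁ 1).grp := by
      apply le_antisymm
      · intro y hy
        exact ⟨hV' hy, mem_conjSubgroup.2 (by simpa using h₁.le_pair hy)⟩
      · rintro y ⟨hy, hy'⟩
        have hy1 : y ∈ V₁.grp := by simpa using mem_conjSubgroup.1 hy'
        obtain ⟨a, ha, b, hb, rfl⟩ := h₁.exists_mul y hy1
        have hb' : b ∈ V'.grp := by
          have := V'.grp.mul_mem (V'.grp.inv_mem (hV' ha)) hy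
          simpa using this
        exact V₁'.grp.mul_mem ha (h₁.le' (h.inf_le ⟨hb', hb⟩))
    exact LevelGroup.ext this
  subst hEq
  rfl

/-- The component at `U'` of the finite pullback `M_Iw(K) → M_Iw(K')`, computed from any pair of
levels as in `IsGoodPair` whose smaller member is contained in `U'`. -/
theorem goodPair_independent (hM : M.IsCartesian) {K K' : Subgroup G} (hKK' : K' ≤ K)
    (hK' : ∃ W : Subgroup G, IsOpen (W : Set G) ∧ W ⊓ K ≤ K')
    (z : M.iw K) {V₁ V₁' V₂ V₂' U' : LevelGroup S}
    (h₁ : IsGoodPair K K' V₁.grp V₁'.grp) (h₂ : IsGoodPair K K' V₂.grp V₂'.grp)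
    (hU₁ : V₁'.grp ≤ U'.grp) (hU₂ : V₂'.grp ≤ U'.grp) :
    M.prPush hU₁ (M.prPull h₁.le_pair (z.1 ⟨V₁, h₁.le⟩)) =
      M.prPush hU₂ (M.prPull h₂.le_pair (z.1 ⟨V₂, h₂.le⟩)) := by
  obtain ⟨V, V', h, hV, hV'⟩ := exists_isGoodPair hKK' hK'
    (V₁.ofLE (V₁.grp ⊓ V₂.grp) (V₁.isOpen.inter V₂.isOpen) inf_le_left)
    (V₁'.ofLE (V₁'.grp ⊓ V₂'.grp) (V₁'.isOpen.inter V₂'.isOpen) inf_le_left)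
    (le_inf h₁.le h₂.le) (le_inf h₁.le' h₂.le')
  have hV1 : V.grp ≤ V₁.grp := hV.trans inf_le_left
  have hV2 : V.grp ≤ V₂.grp := hV.trans inf_le_right
  have hV1' : V'.grp ≤ V₁'.grp := hV'.trans inf_le_left
  have hV2' : V'.grp ≤ V₂'.grp := hV'.trans inf_le_right
  rw [← z.2 ⟨V, h.le⟩ ⟨V₁, h₁.le⟩ hV1, ← z.2 ⟨V, h.le⟩ ⟨V₂, h₂.le⟩ hV2,
    goodPair_compat M hM h₁ h hV1 hV1', goodPair_compat M hM h₂ h hV2 hV2',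
    M.prPush_prPush, M.prPush_prPush]

theorem exists_isGoodPair_le {K K' : Subgroup G} (hKK' : K' ≤ K)
    (hK' : ∃ W : Subgroup G, IsOpen (W : Set G) ∧ W ⊓ K ≤ K')
    (hK : ∃ V₀ : LevelGroup S, K ≤ V₀.grp) (U' : {U : LevelGroup S // K' ≤ U.grp}) :
    ∃ V V' : LevelGroup S, IsGoodPair K K' V.grp V'.grp ∧ V'.grp ≤ U'.1.grp := by
  obtain ⟨V₀, hV₀⟩ := hK
  obtain ⟨V, V', h, -, h'⟩ := exists_isGoodPair hKK' hK' V₀ U'.1 hV₀ U'.2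
  exact ⟨V, V', h, h'⟩

/-- The pullback `pr^⋆ : M_Iw(K) → M_Iw(K')`, for `K` contained in some level group and `K' ⊆ K`
open in `K` (equivalently, if `K` is compact, `K'` is closed of finite index in `K`). -/
def iwPullback (hM : M.IsCartesian) {K K' : Subgroup G} (hKK' : K' ≤ K)
    (hK' : ∃ W : Subgroup G, IsOpen (W : Set G) ∧ W ⊓ K ≤ K')
    (hK : ∃ V₀ : LevelGroup S, K ≤ V₀.grp) : M.iw K →ₗ[A] M.iw K' :=
  have key := exists_isGoodPair_le hKK' hK' hK
  { toFun := fun z => ⟨fun U' =>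
        M.prPush (key U').choose_spec.choose_spec.2
          (M.prPull (key U').choose_spec.choose_spec.1.le_pair
            (z.1 ⟨(key U').choose, (key U').choose_spec.choose_spec.1.le⟩)), by
        intro U₁ U₂ h
        rw [M.prPush_prPush]
        exact goodPair_independent M hM hKK' hK' z (key U₁).choose_spec.choose_spec.1
          (key U₂).choose_spec.choose_spec.1 _ _⟩
    map_add' := by
      intro x y
      ext U'
      simp
    map_smul' := by
      intro c x
      ext U'
      simp }

/-- The characterisation of the pullback on Iwasawa completions: for levels `V' ⊆ V` as in
`IsGoodPair` it is compatible with `pr^⋆ : M(V) → M(V')`. -/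
theorem iwPullback_apply (hM : M.IsCartesian) {K K' : Subgroup G} (hKK' : K' ≤ K)
    (hK' : ∃ W : Subgroup G, IsOpen (W : Set G) ∧ W ⊓ K ≤ K')
    (hK : ∃ V₀ : LevelGroup S, K ≤ V₀.grp) (z : M.iw K) {V V' : LevelGroup S}
    (h : IsGoodPair K K' V.grp V'.grp) :
    (iwPullback M hM hKK' hK' hK z).1 ⟨V', h.le'⟩ = M.prPull h.le_pair (z.1 ⟨V, h.le⟩) := by
  rw [← M.prPush_self le_rfl (M.prPull h.le_pair (z.1 ⟨V, h.le⟩))]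
  exact goodPair_independent M hM hKK' hK' z
    (exists_isGoodPair_le hKK' hK' hK ⟨V', h.le'⟩).choose_spec.choose_spec.1 h _ le_rfl

end FinitePullback

section Pushforward

variable {G : Type*} [Group G] [TopologicalSpace G] [IsTopologicalGroup G]
variable {A : Type w} [CommRing A] {S : Submonoid G}

/-- A pushforward map `ι_⋆ : M_H → M_G`, where `ι` is the inclusion of the closed subgroup `H`:
maps `M_H(U ∩ H) → M_G(U)`, compatible with the pushforwards `[h]_⋆`, and such that for `U ⊆ V`
the composite of `M_H(V ∩ H) → M_G(V)` and `pr^⋆ : M_G(V) → M_G(U)` is the sum, over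
`γ ∈ U \ V / (V ∩ H)`, of the maps
`M_H(V ∩ H) → M_H(γ⁻¹ U γ ∩ H) → M_G(γ⁻¹ U γ) → M_G(U)` given by `pr^⋆`, `ι_⋆` and `[γ⁻¹]_⋆`. -/
structure Pushforward (H : Subgroup G) (hH : IsClosed (H : Set G))
    (MH : CohomologyFunctor.{v} A (S.comap H.subtype)) (MG : CohomologyFunctor.{v'} A S) where
  /-- the maps `M_H(U ∩ H) → M_G(U)` -/
  map : ∀ U : LevelGroup S, MH.obj (U.restrict H hH) →ₗ[A] MG.obj U
  map_push : ∀ (U V : LevelGroup S) (h : H) (hS : (h : G)⁻¹ ∈ S)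
    (hUV : IsArrow (h : G) U.grp V.grp) (x : MH.obj (U.restrict H hH)),
    map V (MH.push (V := V.restrict H hH) h hS (fun y hy => hUV y hy) x) =
      MG.push (h : G) hS hUV (map U x)
  map_pull : ∀ (U V : LevelGroup S) (hUV : U.grp ≤ V.grp) (T : Finset G)
    (hT : IsDoubleCosetReps T V.grp U.grp (V.grp ⊓ H)) (x : MH.obj (V.restrict H hH)),
    MG.prPull hUV (map V x) =
      ∑ γ : T,
        MG.push (U := V.ofLE (conjSubgroup (γ : G) U.grp) (conjSubgroup_isOpen (γ : G) U.isOpen)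
            (conjSubgroup_le hUV (hT.1 γ γ.2))) (V := U) (γ : G)⁻¹
          (by simpa using V.subset _ (hT.1 γ γ.2)) (isArrow_conj_inv _ _)
          (map _ (MH.prPull (V := V.restrict H hH)
            (fun y hy => conjSubgroup_le hUV (hT.1 γ γ.2) hy) x))

end Pushforward

section GroupSchemes

variable (k R : Type*) [CommRing k] [CommRing R] [HopfAlgebra k R]

/-- The points `G(B) = Hom_k(R, B)` of the affine group scheme `G = Spec R` over `k`. -/
def Points (B : Type*) [CommRing B] [Algebra k B] : Type _ := WithConv (R →ₐ[k] B)

variable {k R}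

section

variable {B C : Type*} [CommRing B] [Algebra k B] [CommRing C] [Algebra k C]

/-- The point of `G` given by a homomorphism `R → B`. -/
def Points.mk (φ : R →ₐ[k] B) : Points k R B := WithConv.toConv φ

/-- The value at `g` of the function `f` on `G`. -/
def Points.eval (g : Points k R B) (f : R) : B := g.ofConv f

@[ext]
theorem Points.ext {g h : Points k R B} (H : ∀ f, g.eval f = h.eval f) : g = h :=
  WithConv.ofConv_injective (AlgHom.ext H)

instance : Monoid (Points k R B) := inferInstanceAs (Monoid (WithConv (R →ₐ[k] B)))

theorem Points.mul_eval (g h : Points k R B) (f : R) :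
    (g * h).eval f = Algebra.TensorProduct.lift g.ofConv h.ofConv (fun _ _ => Commute.all _ _)
      (Coalgebra.comul (R := k) f) := by
  have : (g * h).eval f = _ := AlgHom.convMul_apply (R := k) g h f
  rw [this]

theorem Points.one_eval (f : R) :
    (1 : Points k R B).eval f = algebraMap k B (Coalgebra.counit (R := k) f) := rfl

instance : Inv (Points k R B) :=
  ⟨fun g => WithConv.toConv (g.ofConv.comp (HopfAlgebra.antipodeAlgHom k R))⟩

theorem Points.inv_eval (g : Points k R B) (f : R) :
    (g⁻¹).eval f = g.eval (HopfAlgebra.antipode k f) := rfl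

instance : Group (Points k R B) where
  inv_mul_cancel g := by
    have h1 := AlgHom.comp_convMul_distrib (R := k) (C := R) g.ofConv
      (WithConv.toConv (HopfAlgebra.antipodeAlgHom k R)) (WithConv.toConv (AlgHom.id k R))
    rw [AlgHom.antipode_id_cancel] at h1
    apply WithConv.ofConv_injective
    refine Eq.trans (Eq.symm h1) ?_
    apply AlgHom.ext
    intro f
    change g.ofConv (algebraMap k R _) = algebraMap k B _
    simp

/-- Functoriality of `G(B)` in `B`. -/
def Points.map (φ : B →ₐ[k] C) : Points k R B →* Points k R C where
  toFun g := WithConv.toConv (φ.comp g.ofConv)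
  map_one' := by
    ext f
    change φ (algebraMap k B _) = algebraMap k C _
    simp
  map_mul' g h := by
    apply WithConv.ofConv_injective
    exact AlgHom.comp_convMul_distrib φ g h

theorem Points.map_eval (φ : B →ₐ[k] C) (g : Points k R B) (f : R) :
    (Points.map φ g).eval f = φ (g.eval f) := rfl

/-- The points of the closed subgroup scheme `V(I) ⊆ G` cut out by a Hopf ideal `I`. -/
def closedSubgroup (I : Ideal R) [I.IsHopfIdeal k] (B : Type*) [CommRing B] [Algebra k B] :
    Subgroup (Points k R B) where
  carrier := {g | ∀ f ∈ I, g.eval f = 0}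
  mul_mem' := by
    intro g h hg hh f hf
    let g' : R ⧸ I →ₐ[k] B := Ideal.Quotient.liftₐ I g.ofConv hg
    let h' : R ⧸ I →ₐ[k] B := Ideal.Quotient.liftₐ I h.ofConv hh
    have key : Algebra.TensorProduct.lift g.ofConv h.ofConv (fun _ _ => Commute.all _ _) =
        (Algebra.TensorProduct.lift g' h' (fun _ _ => Commute.all _ _)).comp
          (Algebra.TensorProduct.map (Ideal.Quotient.mkₐ k I) (Ideal.Quotient.mkₐ k I)) := by
      ext x
      · change _ = g' (Ideal.Quotient.mk I x) * h' 1
        simp [g']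
        rfl
      · change _ = g' 1 * h' (Ideal.Quotient.mk I x)
        simp [h']
        rfl
    rw [Points.mul_eval, key, AlgHom.comp_apply]
    have h0 : Algebra.TensorProduct.map (Ideal.Quotient.mkₐ k I) (Ideal.Quotient.mkₐ k I)
        (Coalgebra.comul (R := k) f) = 0 :=
      Submodule.IsCoideal.map_mkQ_comul_eq_zero (I := I.restrictScalars k) hf
    rw [h0, map_zero]
  one_mem' := by
    intro f hf
    rw [Points.one_eval]
    have h0 : Coalgebra.counit (R := k) f = 0 :=
      Submodule.IsCoideal.counit_eq_zero (I := I.restrictScalars k) hf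
    rw [h0, map_zero]
  inv_mem' := by
    intro g hg f hf
    rw [Points.inv_eval]
    exact hg _ (Ideal.IsHopfIdeal.antipode_mem (R := k) hf)

/-- The homomorphism `k[T, T⁻¹] → B` sending `T` to the unit `t`. -/
def laurentEval (t : Bˣ) : k[T;T⁻¹] →ₐ[k] B where
  toRingHom := LaurentPolynomial.eval₂ (algebraMap k B) t
  commutes' c := by
    change LaurentPolynomial.eval₂ (algebraMap k B) t (LaurentPolynomial.C c) = _
    simp

/-- The value `η(t) ∈ G(B)` of a cocharacter `η : 𝔾ₘ → G` at `t ∈ Bˣ`. -/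
def cocharAt (η : R →ₐc[k] k[T;T⁻¹]) (t : Bˣ) : Points k R B :=
  Points.mk ((laurentEval t).comp (η : R →ₐ[k] k[T;T⁻¹]))

end

variable (B : Type*) [CommRing B] [Algebra k B]

variable (k) in
/-- The inclusion `B → B[T, T⁻¹]`. -/
def constHom : B →ₐ[k] B[T;T⁻¹] := IsScalarTower.toAlgHom k B B[T;T⁻¹]

variable (k) in
/-- The inclusion `B[X] → B[T, T⁻¹]`. -/
def polyHom : B[X] →ₐ[k] B[T;T⁻¹] := (Polynomial.toLaurentAlg (R := B)).restrictScalars k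

variable (k) in
/-- The specialisation `B[X] → B` at `X = 0`. -/
def zeroHom : B[X] →ₐ[k] B := (Polynomial.aeval (0 : B)).restrictScalars k

/-- The unit `T ^ n` of `B[T, T⁻¹]`. -/
def unitT (n : ℤ) : (B[T;T⁻¹])ˣ where
  val := LaurentPolynomial.T n
  inv := LaurentPolynomial.T (-n)
  val_inv := by rw [← LaurentPolynomial.T_add]; simp
  inv_val := by rw [← LaurentPolynomial.T_add]; simp

variable (η : R →ₐc[k] k[T;T⁻¹]) (n : ℤ)

/-- The map `g ↦ η(t)ⁿ g η(t)⁻ⁿ`, as a `B[t, t⁻¹]`-point of `G`. -/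
def conjCochar : Points k R B →* Points k R B[T;T⁻¹] :=
  (MulAut.conj (cocharAt η (unitT B n))).toMonoidHom.comp (Points.map (constHom k B))

/-- The `B`-points of `P_G(η ^ n)`: those `g` for which `lim_{t → 0} η(t)ⁿ g η(t)⁻ⁿ` exists. -/
def dynParabolic : Subgroup (Points k R B) :=
  (Points.map (R := R) (polyHom k B)).range.comap (conjCochar B η n)

/-- The `B`-points of `U_G(η ^ n)`: those `g` for which `lim_{t → 0} η(t)ⁿ g η(t)⁻ⁿ = 1`. -/
def dynUnipotent : Subgroup (Points k R B) :=
  ((Points.map (R := R) (zeroHom k B)).ker.map (Points.map (polyHom k B))).comap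
    (conjCochar B η n)

/-- The `B`-points of the centraliser `Z_G(η)`. -/
def dynLevi : Subgroup (Points k R B) :=
  (conjCochar B η 1).eqLocus (Points.map (constHom k B))

variable {B}

/-- The ideal of the closed subgroup scheme `P_G(η ^ n)`: it is generated by the coefficients of
the negative powers of `t` in `f(η(t)ⁿ g η(t)⁻ⁿ)`, where `f ∈ R` and `g` is the universal point. -/
def dynParabolicIdeal : Ideal R :=
  Ideal.span {c | ∃ (f : R) (m : ℤ), m < 0 ∧
    c = ((conjCochar R η n (Points.mk (AlgHom.id k R))).eval f).coeff m}

/-- Base change of Laurent polynomials. -/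
def laurentMap {C : Type*} [CommRing C] [Algebra k C] (φ : B →ₐ[k] C) : B[T;T⁻¹] →ₐ[k] C[T;T⁻¹] :=
  AddMonoidAlgebra.mapAlgHom ℤ φ

theorem coeff_laurentMap {C : Type*} [CommRing C] [Algebra k C] (φ : B →ₐ[k] C)
    (x : B[T;T⁻¹]) (m : ℤ) : (laurentMap φ x).coeff m = φ (x.coeff m) := by
  simp [laurentMap]

theorem conjCochar_map {C : Type*} [CommRing C] [Algebra k C] (φ : B →ₐ[k] C) (g : Points k R B) :
    conjCochar C η n (Points.map φ g) = Points.map (laurentMap φ) (conjCochar B η n g) := by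
  have h1 : cocharAt η (unitT C n) = Points.map (laurentMap φ) (cocharAt η (unitT B n)) := by
    apply WithConv.ofConv_injective
    change (laurentEval (unitT C n)).comp _ = (laurentMap φ).comp ((laurentEval (unitT B n)).comp _)
    rw [← AlgHom.comp_assoc]
    congr 1
    have hu : Units.map (laurentMap φ : B[T;T⁻¹] →* C[T;T⁻¹]) (unitT B n) = unitT C n := by
      ext m
      simp [unitT, coeff_laurentMap, apply_ite φ]
    apply AlgHom.ext
    intro x
    induction x using LaurentPolynomial.induction_on' with
    | add x y hx hy => rw [map_add, map_add, hx, hy]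
    | C_mul_T m a =>
      change LaurentPolynomial.eval₂ _ _ _ = laurentMap φ (LaurentPolynomial.eval₂ _ _ _)
      rw [LaurentPolynomial.eval₂_C_mul_T, LaurentPolynomial.eval₂_C_mul_T, ← hu, ← map_zpow,
        map_mul, AlgHom.commutes]
      rfl
  have h2 : Points.map (constHom k C) (Points.map φ g) =
      Points.map (laurentMap φ) (Points.map (constHom k B) g) := by
    ext1 f
    change LaurentPolynomial.C (φ (g.eval f)) = laurentMap φ (LaurentPolynomial.C (g.eval f))
    ext m
    simp [coeff_laurentMap, apply_ite φ]
  simp only [conjCochar, MonoidHom.comp_apply, MulEquiv.coe_toMonoidHom, MulAut.conj_apply, h1, h2,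
    map_mul, map_inv]

theorem coeff_polyHom_of_neg (x : B[X]) {m : ℤ} (hm : m < 0) : (polyHom k B x).coeff m = 0 := by
  by_contra h
  have h1 : m ∈ (Polynomial.toLaurent x).coeff.support := Finsupp.mem_support_iff.2 h
  rw [LaurentPolynomial.support_coeff_toLaurent, Finset.mem_map] at h1
  obtain ⟨a, -, ha⟩ := h1
  have : (a : ℤ) = m := ha
  omega

theorem mem_range_polyHom (x : B[T;T⁻¹]) (hx : ∀ m < 0, x.coeff m = 0) :
    x ∈ (polyHom k B).range := by
  rw [← AddMonoidAlgebra.sum_coeff_single x, Finsupp.sum]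
  refine Subalgebra.sum_mem _ fun m hm => ?_
  have hm' : 0 ≤ m := by
    by_contra h
    exact Finsupp.mem_support_iff.1 hm (hx m (not_le.1 h))
  lift m to ℕ using hm'
  refine ⟨Polynomial.C (x.coeff m) * Polynomial.X ^ m, ?_⟩
  change Polynomial.toLaurent _ = _
  rw [Polynomial.toLaurent_C_mul_X_pow, ← LaurentPolynomial.single_eq_C_mul_T]

/-- The ideal `dynParabolicIdeal` represents the functor `dynParabolic`. -/
theorem mem_dynParabolic_iff (g : Points k R B) :
    g ∈ dynParabolic B η n ↔ ∀ c ∈ dynParabolicIdeal η n, g.eval c = 0 := by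
  have h1 : ∀ (f : R) (m : ℤ), ((conjCochar B η n g).eval f).coeff m =
      g.eval (((conjCochar R η n (Points.mk (AlgHom.id k R))).eval f).coeff m) := by
    intro f m
    have h2 : g = Points.map g.ofConv (Points.mk (AlgHom.id k R)) := rfl
    conv_lhs => rw [h2, conjCochar_map, Points.map_eval, coeff_laurentMap]
    rfl
  constructor
  · rintro ⟨h, hh⟩ c hc
    have hker : dynParabolicIdeal η n ≤ RingHom.ker g.ofConv := by
      refine Ideal.span_le.2 ?_
      rintro _ ⟨f, m, hm, rfl⟩
      change g.eval _ = 0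
      rw [← h1, ← hh]
      exact coeff_polyHom_of_neg (k := k) (h.eval f) hm
    exact hker hc
  · intro hg
    have h2 : ∀ f : R, (conjCochar B η n g).eval f ∈ (polyHom k B).range := by
      intro f
      exact mem_range_polyHom _ fun m hm => by
        rw [h1]
        exact hg _ (Ideal.subset_span ⟨f, m, hm, rfl⟩)
    let e := AlgEquiv.ofInjective (polyHom k B) Polynomial.toLaurent_injective
    refine ⟨Points.mk ((e.symm : _ →ₐ[k] B[X]).comp
      ((conjCochar B η n g).ofConv.codRestrict _ h2)), ?_⟩
    ext1 f
    exact congr_arg Subtype.val (e.apply_symm_apply ⟨(conjCochar B η n g).eval f, h2 f⟩)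

end GroupSchemes

section Topology

variable {k R : Type*} [CommRing k] [CommRing R] [HopfAlgebra k R]
variable {B : Type*} [CommRing B] [Algebra k B] [TopologicalSpace B]

/-- The topology on `G(B)`: the coarsest one for which all functions `f ∈ R` are continuous. -/
instance : TopologicalSpace (Points k R B) :=
  TopologicalSpace.induced (fun g (f : R) => g.eval f) inferInstance

theorem Points.continuous_eval (f : R) : Continuous fun g : Points k R B => g.eval f :=
  (continuous_apply f).comp continuous_induced_dom

theorem Points.continuous_iff {X : Type*} [TopologicalSpace X] {F : X → Points k R B} :
    Continuous F ↔ ∀ f : R, Continuous fun x => (F x).eval f := by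
  rw [continuous_induced_rng, continuous_pi_iff]
  rfl

instance [IsTopologicalRing B] : IsTopologicalGroup (Points k R B) where
  continuous_mul := by
    rw [Points.continuous_iff]
    intro f
    simp only [Points.mul_eval]
    induction (Coalgebra.comul (R := k) f) using TensorProduct.induction_on with
    | zero => simpa using continuous_const
    | tmul x y =>
      simp only [Algebra.TensorProduct.lift_tmul]
      exact ((Points.continuous_eval x).comp continuous_fst).mul
        ((Points.continuous_eval y).comp continuous_snd)
    | add x y hx hy =>
      simp only [map_add]
      exact hx.add hy
  continuous_inv := by
    rw [Points.continuous_iff]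
    intro f
    exact Points.continuous_eval _

theorem closedSubgroup_isClosed [T1Space B] (I : Ideal R) [I.IsHopfIdeal k] :
    IsClosed (closedSubgroup (k := k) I B : Set (Points k R B)) := by
  have : (closedSubgroup (k := k) I B : Set (Points k R B)) = ⋂ f ∈ I, {g | g.eval f = 0} := by
    ext g
    simp [closedSubgroup]
  rw [this]
  exact isClosed_biInter fun f _ => isClosed_singleton.preimage (Points.continuous_eval f)

end Topology

section Padic

variable {p : ℕ} [Fact p.Prime] {R : Type*} [CommRing R] [HopfAlgebra ℤ_[p] R]

/-- The inclusion `G(ℤ_p) → G(ℚ_p)`. -/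
def inclQp : Points ℤ_[p] R ℤ_[p] →* Points ℤ_[p] R ℚ_[p] :=
  Points.map (Algebra.ofId ℤ_[p] ℚ_[p])

/-- Reduction modulo `p ^ r`, from `G(ℤ_p)` to `G(ℤ_p / p ^ r)`. -/
def redMod (r : ℕ) : Points ℤ_[p] R ℤ_[p] →*
    Points ℤ_[p] R (ℤ_[p] ⧸ Ideal.span {(p : ℤ_[p]) ^ r}) :=
  Points.map (Ideal.Quotient.mkₐ ℤ_[p] (Ideal.span {(p : ℤ_[p]) ^ r}))

theorem inclQp_eval (g : Points ℤ_[p] R ℤ_[p]) (f : R) :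
    (inclQp g).eval f = (g.eval f : ℚ_[p]) := rfl

theorem inclQp_continuous : Continuous (inclQp : Points ℤ_[p] R ℤ_[p] → _) := by
  rw [Points.continuous_iff]
  intro f
  have hc : Continuous (fun x : ℤ_[p] => (x : ℚ_[p])) := PadicInt.isOpenEmbedding_coe.continuous
  exact hc.comp (Points.continuous_eval (k := ℤ_[p]) (R := R) (B := ℤ_[p]) f)

theorem inclQp_isInducing : Topology.IsInducing (inclQp : Points ℤ_[p] R ℤ_[p] → _) := by
  have h1 : Topology.IsInducing (fun (g : Points ℤ_[p] R ℤ_[p]) (f : R) => g.eval f) := ⟨rfl⟩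
  have h2 : Topology.IsInducing (fun (φ : R → ℤ_[p]) (f : R) => (φ f : ℚ_[p])) :=
    Topology.IsInducing.piMap fun _ => PadicInt.isOpenEmbedding_coe.isInducing
  exact Topology.IsInducing.of_comp inclQp_continuous continuous_induced_dom (h2.comp h1)

theorem mem_range_inclQp {g : Points ℤ_[p] R ℚ_[p]} (s : Set R)
    (hs : Algebra.adjoin ℤ_[p] s = ⊤) (hg : ∀ f ∈ s, ‖g.eval f‖ ≤ 1) :
    g ∈ (inclQp : Points ℤ_[p] R ℤ_[p] →* _).range := by
  have key : ∀ f : R, ‖g.eval f‖ ≤ 1 := by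
    intro f
    have hf : f ∈ Algebra.adjoin ℤ_[p] s := hs ▸ Algebra.mem_top
    induction hf using Algebra.adjoin_induction with
    | mem x hx => exact hg x hx
    | algebraMap c =>
      change ‖g.ofConv (algebraMap ℤ_[p] R c)‖ ≤ 1
      rw [AlgHom.commutes]
      exact c.2
    | add x y _ _ hx hy =>
      change ‖g.ofConv (x + y)‖ ≤ 1
      rw [map_add]
      exact (IsUltrametricDist.norm_add_le_max _ _).trans (max_le hx hy)
    | mul x y _ _ hx hy =>
      change ‖g.ofConv (x * y)‖ ≤ 1
      rw [map_mul, norm_mul]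
      exact mul_le_one₀ hx (norm_nonneg _) hy
  refine ⟨WithConv.toConv
    { toFun := fun f => ⟨g.eval f, key f⟩
      map_one' := Subtype.ext (map_one g.ofConv)
      map_mul' := fun x y => Subtype.ext (map_mul g.ofConv x y)
      map_zero' := Subtype.ext (map_zero g.ofConv)
      map_add' := fun x y => Subtype.ext (map_add g.ofConv x y)
      commutes' := fun c => Subtype.ext (g.ofConv.commutes c) }, ?_⟩
  ext f
  rfl

instance : CompactSpace (Points ℤ_[p] R ℤ_[p]) := by
  have hinj : Function.Injective (fun (g : Points ℤ_[p] R ℤ_[p]) (f : R) => g.eval f) :=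
    fun g h H => Points.ext (congr_fun H)
  have hrange : Set.range (fun (g : Points ℤ_[p] R ℤ_[p]) (f : R) => g.eval f) =
      (⋂ c : ℤ_[p], {φ : R → ℤ_[p] | φ (algebraMap ℤ_[p] R c) = c}) ∩
      ((⋂ x : R, ⋂ y : R, {φ : R → ℤ_[p] | φ (x + y) = φ x + φ y}) ∩
       (⋂ x : R, ⋂ y : R, {φ : R → ℤ_[p] | φ (x * y) = φ x * φ y})) := by
    ext φ
    simp only [Set.mem_range, Set.mem_inter_iff, Set.mem_iInter, Set.mem_ofPred_eq]
    constructor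
    · rintro ⟨g, rfl⟩
      exact ⟨fun c => g.ofConv.commutes c, fun x y => map_add g.ofConv x y,
        fun x y => map_mul g.ofConv x y⟩
    · rintro ⟨h1, h2, h3⟩
      refine ⟨WithConv.toConv
        { toFun := φ
          map_one' := by simpa using h1 1
          map_mul' := h3
          map_zero' := by simpa using h1 0
          map_add' := h2
          commutes' := h1 }, rfl⟩
  have hclosed : IsClosed (Set.range fun (g : Points ℤ_[p] R ℤ_[p]) (f : R) => g.eval f) := by
    rw [hrange]
    refine IsClosed.inter ?_ (IsClosed.inter ?_ ?_)
    · exact isClosed_iInter fun c => isClosed_eq (continuous_apply _) continuous_const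
    · exact isClosed_iInter fun x => isClosed_iInter fun y => isClosed_eq (by fun_prop)
        (by fun_prop)
    · exact isClosed_iInter fun x => isClosed_iInter fun y => isClosed_eq (by fun_prop)
        (by fun_prop)
  have hemb : Topology.IsClosedEmbedding
      (fun (g : Points ℤ_[p] R ℤ_[p]) (f : R) => g.eval f) :=
    ⟨⟨⟨rfl⟩, hinj⟩, hclosed⟩
  exact hemb.compactSpace

theorem range_inclQp_isOpen [Algebra.FiniteType ℤ_[p] R] :
    IsOpen ((inclQp : Points ℤ_[p] R ℤ_[p] →* _).range : Set (Points ℤ_[p] R ℚ_[p])) := by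
  obtain ⟨s, hs⟩ := (inferInstance : Algebra.FiniteType ℤ_[p] R).out
  have : ((inclQp : Points ℤ_[p] R ℤ_[p] →* _).range : Set (Points ℤ_[p] R ℚ_[p])) =
      ⋂ f ∈ s, {g | g.eval f ∈ Metric.closedBall (0 : ℚ_[p]) 1} := by
    ext g
    simp only [Set.mem_iInter, Set.mem_ofPred_eq, mem_closedBall_zero_iff]
    constructor
    · rintro ⟨g, rfl⟩ f -
      exact (g.eval f).2
    · intro h
      exact mem_range_inclQp (s : Set R) hs (fun f hf => h f hf)
  rw [this]
  exact isOpen_biInter_finset fun f _ =>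
    (IsUltrametricDist.isOpen_closedBall (0 : ℚ_[p]) one_ne_zero).preimage
      (Points.continuous_eval f)

theorem range_inclQp_isCompact :
    IsCompact ((inclQp : Points ℤ_[p] R ℤ_[p] →* _).range : Set (Points ℤ_[p] R ℚ_[p])) := by
  rw [MonoidHom.coe_range]
  exact isCompact_range inclQp_continuous

theorem ker_redMod_isOpen [Algebra.FiniteType ℤ_[p] R] (r : ℕ) :
    IsOpen ((redMod (p := p) (R := R) r).ker : Set (Points ℤ_[p] R ℤ_[p])) := by
  obtain ⟨s, hs⟩ := (inferInstance : Algebra.FiniteType ℤ_[p] R).out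
  have : ((redMod (p := p) (R := R) r).ker : Set (Points ℤ_[p] R ℤ_[p])) =
      ⋂ f ∈ s, {g | g.eval f ∈ Metric.closedBall
        ((1 : Points ℤ_[p] R ℤ_[p]).eval f) ((p : ℝ) ^ (-(r : ℤ)))} := by
    ext g
    simp only [Set.mem_iInter, Set.mem_ofPred_eq, mem_closedBall_iff_norm,
      PadicInt.norm_le_pow_iff_mem_span_pow, ← Ideal.Quotient.eq]
    constructor
    · intro h f _
      have h' : redMod r g = redMod r 1 := by
        rw [map_one]
        exact h
      exact congr_arg (fun x => x.eval f) h'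
    · intro h
      change redMod r g = 1
      rw [← map_one (redMod r)]
      apply WithConv.ofConv_injective
      exact AlgHom.ext_of_adjoin_eq_top hs (fun f hf => h f hf)
  rw [this]
  have hp : (p : ℝ) ^ (-(r : ℤ)) ≠ 0 :=
    zpow_ne_zero _ (Nat.cast_ne_zero.2 (Fact.out : p.Prime).ne_zero)
  exact isOpen_biInter_finset fun f _ =>
    (IsUltrametricDist.isOpen_closedBall _ hp).preimage (Points.continuous_eval f)

theorem map_comap_redMod_isOpen [Algebra.FiniteType ℤ_[p] R] (r : ℕ)
    (X : Subgroup (Points ℤ_[p] R (ℤ_[p] ⧸ Ideal.span {(p : ℤ_[p]) ^ r}))) :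
    IsOpen ((X.comap (redMod r)).map inclQp : Set (Points ℤ_[p] R ℚ_[p])) := by
  have h1 : IsOpen (X.comap (redMod r) : Set (Points ℤ_[p] R ℤ_[p])) :=
    Subgroup.isOpen_mono (fun g hg => by
      rw [MonoidHom.mem_ker] at hg
      rw [Subgroup.mem_comap, hg]
      exact X.one_mem) (ker_redMod_isOpen r)
  have h2 : Topology.IsInducing (inclQp : Points ℤ_[p] R ℤ_[p] → _) := inclQp_isInducing
  have h3 := range_inclQp_isOpen (p := p) (R := R)
  rw [MonoidHom.coe_range] at h3
  exact h2.isOpenMap h3 _ h1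

end Padic

section Machine

variable (p : ℕ) [Fact p.Prime]

/-- The algebraic data: a smooth affine group scheme `G = Spec R` over `ℤ_p`, closed subgroup
schemes `Q_H⁰ ⊆ H ⊆ G`, a cocharacter `η` of `G`, a closed normal subgroup scheme `L_G⁰` of the
centraliser `L_G = Z_G(η)`, and a point `u ∈ G(ℤ_p)`.

The main case is that of reductive groups `H ⊆ G` and a mirabolic subgroup `Q_H⁰` of `H`. If `G` is
reductive, then `Q_G = P_G(η)` is a parabolic subgroup with Levi factor `L_G = Z_G(η)`, unipotent
radical `N_G = U_G(η)` and opposite `Q̄_G = P_G(η⁻¹)`, whose unipotent radical is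
`N̄_G = U_G(η⁻¹)`. Conversely, if `Q_G` is a parabolic subgroup with Levi factor `L_G` and the
cocharacter `η` is central in `L_G` and strictly dominant (it pairs positively with every relative
root of `G` with respect to `Q_G`), then `Q_G = P_G(η)`, `L_G = Z_G(η)`, `N_G = U_G(η)`, and so
on. -/
structure GroupDatum where
  /-- the coordinate ring of `G` -/
  R : Type
  [commRing : CommRing R]
  [hopf : HopfAlgebra ℤ_[p] R]
  [smooth : Algebra.Smooth ℤ_[p] R]
  /-- the ideal of `H` -/
  idealH : Ideal R
  [isHopfH : idealH.IsHopfIdeal ℤ_[p]]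
  /-- the ideal of `Q_H⁰` -/
  idealQ : Ideal R
  [isHopfQ : idealQ.IsHopfIdeal ℤ_[p]]
  /-- `Q_H⁰ ⊆ H` -/
  le_Q : idealH ≤ idealQ
  /-- the cocharacter `η : 𝔾ₘ → G` -/
  η : R →ₐc[ℤ_[p]] ℤ_[p][T;T⁻¹]
  /-- the ideal of `L_G⁰` -/
  idealL : Ideal R
  [isHopfL : idealL.IsHopfIdeal ℤ_[p]]
  /-- `L_G⁰ ⊆ L_G` -/
  L_le : ∀ (B : Type) [CommRing B] [Algebra ℤ_[p] B],
    closedSubgroup (k := ℤ_[p]) idealL B ≤ dynLevi B η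
  /-- `L_G⁰` is normal in `L_G` -/
  L_normal : ∀ (B : Type) [CommRing B] [Algebra ℤ_[p] B], ∀ l ∈ dynLevi B η,
    ∀ x ∈ closedSubgroup (k := ℤ_[p]) idealL B, l * x * l⁻¹ ∈ closedSubgroup idealL B
  /-- the point `u ∈ G(ℤ_p)` -/
  u : Points ℤ_[p] R ℤ_[p]

attribute [instance] GroupDatum.commRing GroupDatum.hopf GroupDatum.smooth GroupDatum.isHopfH
  GroupDatum.isHopfQ GroupDatum.isHopfL

variable {p}

namespace GroupDatum

variable (D : GroupDatum p)

/-- The group `G(ℚ_p)`. -/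
abbrev GQp : Type := Points ℤ_[p] D.R ℚ_[p]

/-- The subgroup `G(ℤ_p)` of `G(ℚ_p)`. -/
def GZp : Subgroup D.GQp := (inclQp (R := D.R)).range

/-- The subgroup `H = H(ℚ_p)` of `G(ℚ_p)`. -/
def HQp : Subgroup D.GQp := closedSubgroup D.idealH ℚ_[p]

/-- The subgroup `Q_H⁰(ℤ_p)` of `H(ℚ_p)`. -/
def QZp : Subgroup D.HQp :=
  ((closedSubgroup D.idealQ ℤ_[p]).map inclQp).subgroupOf D.HQp

/-- The points of `Q̄_G⁰ = N̄_G L_G⁰`, where `N̄_G = U_G(η⁻¹)` is the unipotent radical of the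
parabolic `Q̄_G = P_G(η⁻¹)` opposite to `Q_G = P_G(η)`. -/
def Qbar0 (B : Type) [CommRing B] [Algebra ℤ_[p] B] : Subgroup (Points ℤ_[p] D.R B) :=
  dynUnipotent B D.η (-1) ⊔ closedSubgroup D.idealL B

/-- The coordinate ring of `Q_H⁰ × Q̄_G`. -/
abbrev orbitRing : Type :=
  (D.R ⧸ D.idealQ) ⊗[ℤ_[p]] (D.R ⧸ dynParabolicIdeal D.η (-1))

/-- The morphism `Q_H⁰ × Q̄_G → G`, `(q, b) ↦ q u b`, as a point of `G` with values in the
coordinate ring of `Q_H⁰ × Q̄_G`. It is the pullback along `G → G / Q̄_G` of the orbit map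
`Q_H⁰ → G / Q̄_G`, `q ↦ q u`. -/
def orbitMap : Points ℤ_[p] D.R D.orbitRing :=
  Points.mk (Algebra.TensorProduct.includeLeft.comp (Ideal.Quotient.mkₐ ℤ_[p] D.idealQ)) *
    Points.map (Algebra.ofId ℤ_[p] D.orbitRing) D.u *
    Points.mk (Algebra.TensorProduct.includeRight.comp
      (Ideal.Quotient.mkₐ ℤ_[p] (dynParabolicIdeal D.η (-1))))

/-- Condition (A): the orbit of `u` under `Q_H⁰` is open in `G / Q̄_G`, in the sense that the orbit
map `Q_H⁰ → G / Q̄_G` is smooth. Smoothness is tested after the smooth base change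
`G → G / Q̄_G`. -/
def ConditionA : Prop := (D.orbitMap.ofConv : D.R →+* D.orbitRing).Smooth

/-- Condition (B): `u⁻¹ Q_H⁰ u ∩ Q̄_G ⊆ Q̄_G⁰` as subgroup schemes of `G`. -/
def ConditionB : Prop :=
  ∀ (B : Type) [CommRing B] [Algebra ℤ_[p] B], ∀ q ∈ closedSubgroup (k := ℤ_[p]) D.idealQ B,
    (Points.map (Algebra.ofId ℤ_[p] B) D.u)⁻¹ * q * Points.map (Algebra.ofId ℤ_[p] B) D.u ∈
      dynParabolic B D.η (-1) →
    (Points.map (Algebra.ofId ℤ_[p] B) D.u)⁻¹ * q * Points.map (Algebra.ofId ℤ_[p] B) D.u ∈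
      D.Qbar0 B

/-- The prime `p` as a unit of `ℚ_p`. -/
def unitP : (ℚ_[p])ˣ :=
  Units.mk0 (p : ℚ_[p]) (Nat.cast_ne_zero.2 (Fact.out : p.Prime).ne_zero)

/-- The element `τ = η(p)` of `G(ℚ_p)`. -/
def tau : D.GQp := cocharAt D.η unitP

/-- The group `U_r` of those `g ∈ G(ℤ_p)` with `τ⁻ʳ g τʳ ∈ G(ℤ_p)` and
`g mod p ^ r ∈ Q̄_G⁰(ℤ / p ^ r)`. -/
def Ugrp (r : ℕ) : Subgroup D.GQp :=
  ((D.Qbar0 (ℤ_[p] ⧸ Ideal.span {(p : ℤ_[p]) ^ r})).comap (redMod r)).map inclQp ⊓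
    conjSubgroup (D.tau ^ r)⁻¹ D.GZp

theorem Ugrp_le (r : ℕ) : D.Ugrp r ≤ D.GZp := by
  rintro _ ⟨⟨g, -, rfl⟩, -⟩
  exact ⟨g, rfl⟩

theorem conj_Ugrp_le (r : ℕ) : conjSubgroup (D.tau ^ r) (D.Ugrp r) ≤ D.GZp := by
  intro g hg
  have := mem_conjSubgroup.1 (mem_conjSubgroup.1 hg).2
  simpa [mul_assoc] using this

theorem HQp_isClosed : IsClosed (D.HQp : Set D.GQp) := closedSubgroup_isClosed D.idealH

variable {S : Submonoid D.GQp}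

/-- `G(ℤ_p)` as a level group. -/
def G0 (hS : ∀ g ∈ D.GZp, g ∈ S) : LevelGroup S where
  grp := D.GZp
  isOpen := range_inclQp_isOpen
  isCompact := range_inclQp_isCompact
  subset := hS

/-- The level group `U_r`. -/
def U (hS : ∀ g ∈ D.GZp, g ∈ S) (r : ℕ) : LevelGroup S :=
  (D.G0 hS).ofLE (D.Ugrp r)
    ((map_comap_redMod_isOpen r _).inter (conjSubgroup_isOpen _ range_inclQp_isOpen))
    (D.Ugrp_le r)

/-- The level group `V_r = τ⁻ʳ U_r τʳ`. -/
def V (hS : ∀ g ∈ D.GZp, g ∈ S) (r : ℕ) : LevelGroup S :=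
  (D.U hS r).conj (D.tau ^ r) fun g hg => hS g (D.conj_Ugrp_le r hg)

/-- The level group `u U_r u⁻¹`. -/
def W (hS : ∀ g ∈ D.GZp, g ∈ S) (r : ℕ) : LevelGroup S :=
  (D.U hS r).conj (inclQp D.u)⁻¹ fun g hg => hS g <| by
    have h1 : inclQp D.u ∈ D.GZp := ⟨D.u, rfl⟩
    have h2 := D.Ugrp_le r (mem_conjSubgroup.1 hg)
    have h3 := D.GZp.mul_mem (D.GZp.mul_mem h1 h2) (D.GZp.inv_mem h1)
    simpa [mul_assoc] using h3

theorem QZp_le (hS : ∀ g ∈ D.GZp, g ∈ S) :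
    D.QZp ≤ ((D.G0 hS).restrict D.HQp D.HQp_isClosed).grp := by
  rintro h ⟨g, -, hg⟩
  exact ⟨g, hg⟩

variable {A : Type w} [CommRing A] {MH : CohomologyFunctor.{v} A (S.comap D.HQp.subtype)}
  {MG : CohomologyFunctor.{v'} A S}

/-- The class `z_{G,r} ∈ M_G(U_r)`: the image of `z_H` under the maps
`M_{H,Iw}(Q_H⁰(ℤ_p)) → M_{H,Iw}(Q_H⁰(ℤ_p) ∩ u U_r u⁻¹) → M_H(H ∩ u U_r u⁻¹) → M_G(u U_r u⁻¹) →
M_G(U_r)` given by `pr^⋆`, projection, `ι_⋆` and `[u]_⋆`. -/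
def zG (hS : ∀ g ∈ D.GZp, g ∈ S) (hMH : MH.IsCartesian)
    (ι : Pushforward D.HQp D.HQp_isClosed MH MG) (zH : MH.iw D.QZp) (r : ℕ) :
    MG.obj (D.U hS r) :=
  MG.push (inclQp D.u) (hS _ (D.GZp.inv_mem ⟨D.u, rfl⟩))
    (isArrow_conj_inv_left (inclQp D.u) (D.Ugrp r))
    (ι.map (D.W hS r)
      ((iwPullback MH hMH (K' := D.QZp ⊓ ((D.W hS r).restrict D.HQp D.HQp_isClosed).grp)
        inf_le_left ⟨_, ((D.W hS r).restrict D.HQp D.HQp_isClosed).isOpen, by rw [inf_comm]⟩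
        ⟨_, D.QZp_le hS⟩ zH).1 ⟨(D.W hS r).restrict D.HQp D.HQp_isClosed, inf_le_right⟩))

theorem inv_pow_mem (hτ : D.tau⁻¹ ∈ S) (r : ℕ) : (D.tau ^ r)⁻¹ ∈ S := by
  rw [← inv_pow]
  exact S.pow_mem hτ r

/-- The class `ξ_{G,r} = [τʳ]_⋆ z_{G,r} ∈ M_G(V_r)`. -/
def xiG (hS : ∀ g ∈ D.GZp, g ∈ S) (hτ : D.tau⁻¹ ∈ S) (hMH : MH.IsCartesian)
    (ι : Pushforward D.HQp D.HQp_isClosed MH MG) (zH : MH.iw D.QZp) (r : ℕ) :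
    MG.obj (D.V hS r) :=
  MG.push (D.tau ^ r) (D.inv_pow_mem hτ r) (isArrow_conj (D.tau ^ r) (D.Ugrp r)) (D.zG hS hMH ι zH r)

end GroupDatum

end Machine

end NormRelations

end

open NormRelations

/-! Conjugation by `τ⁻¹` acts on functions on `G` through weights: if `c_m` is the coefficient of `T
^ m` in `f(η(T)⁻¹ g η(T))`, then replacing `g` by `τ⁻ʳ g τʳ` multiplies `c_m` by `p ^ (r m)`. So
`τ⁻ʳ g τʳ` is integral exactly when each `p ^ (r m) c_m` is. This only constrains negative weights,
and it forces `g mod p ^ r` into `Q̄_G`. The remaining condition for `g ∈ U_r` is that the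
weight-zero coefficients of functions in the ideal of `L_G⁰` are divisible by `p ^ r`; conjugation
by `τ` does not change them.

Put `U' = U_r ∩ τ U_r τ⁻¹`, which contains `U_{r+1}`. Two facts about `U'` carry the proof. (A)
gives `U_r = U' · (U_r ∩ u⁻¹ Q_H⁰(ℤ_p) u)` (`exists_mul_of_conditionA`): for `g ∈ U_r`, the equation
`q u b = u g⁻¹` has the solution `(1, g⁻¹)` modulo `p ^ r`, which smoothness lifts to `ℤ_p`. (B)
gives that `U'` and `U_{r+1}` meet `u⁻¹ Q_H⁰(ℤ_p) u` in the same group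
(`mem_Ugrp_succ_of_conditionB`): an element of `U'` reduces into `Q̄_G` modulo `p ^ (r+1)`, and (B)
moves it into `Q̄_G⁰`.

By the first fact the double coset sum in the base change formula for `ι_⋆` has one term; by the
second the resulting class comes from level `r + 1`. Hence `pr^⋆ z_{G,r} = pr_⋆ z_{G,r+1}` in
`M_G(U')` (`prPull_zG`), and `[τ]_⋆` turns this into the relation at `U_r`. The relation at `V_r` is
its transport under `[τʳ]_⋆`. -/

namespace NormRelations

universe v v' w

/-! ### Lifting points along smooth ring homomorphisms. -/

section SmoothLifting

/-- For `r ≥ 1` the filtrations by `I ^ n` and by `I ^ (r n)` are cofinal. The case needed is the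
ideal `(p ^ r)` of `ℤ_p`. -/
theorem isAdicComplete_pow {S : Type*} [CommRing S] (I : Ideal S) [IsAdicComplete I S] {r : ℕ}
    (hr : 1 ≤ r) : IsAdicComplete (I ^ r) S where
  haus' x hx := by
    refine IsHausdorff.haus (I := I) inferInstance x fun n => ?_
    refine SModEq.mono ?_ (hx n)
    rw [← pow_mul]
    exact Submodule.smul_mono_left (Ideal.pow_le_pow_right (Nat.le_mul_of_pos_left n hr))
  prec' x hx := by
    have hle : ∀ {m n : ℕ}, m ≤ r * n → I ^ (r * n) ≤ I ^ m := fun h => Ideal.pow_le_pow_right h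
    simp only [← pow_mul] at hx ⊢
    obtain ⟨L, hL⟩ := IsPrecomplete.prec (I := I) (M := S) inferInstance (f := x)
      (fun {m n} hmn => SModEq.mono
        (Submodule.smul_mono_left (hle (Nat.le_mul_of_pos_left m hr))) (hx hmn))
    -- The limit `L` is only known to agree with `x n` modulo `I ^ n`. Comparing with the later term
    -- `x (r * n)` gives the required exponent `r * n`.
    exact ⟨L, fun n => (hx (Nat.le_mul_of_pos_left n hr)).trans (hL (r * n))⟩

/-- Lifting along `S → S / I ^ r` for a smooth ring homomorphism, if `S` is `I`-adically
complete. -/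
theorem exists_lift_of_smooth {R T : Type*} {S : Type*} [CommRing R] [CommRing T] [CommRing S]
    {f : R →+* T} (hf : f.Smooth) (J : Ideal S) [IsAdicComplete J S] (φ : R →+* S)
    (ψ : T →+* S ⧸ J) (h : ψ.comp f = (Ideal.Quotient.mk J).comp φ) :
    ∃ Ψ : T →+* S, Ψ.comp f = φ ∧ (Ideal.Quotient.mk J).comp Ψ = ψ := by
  let _ : Algebra R T := f.toAlgebra
  let _ : Algebra R S := φ.toAlgebra
  have : Algebra.Smooth R T := hf
  have : Algebra.FormallySmooth R T := this.formallySmooth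
  let ψ' : T →ₐ[R] S ⧸ J := { ψ with commutes' := fun x => RingHom.congr_fun h x }
  obtain ⟨g, hg⟩ := Algebra.FormallySmooth.exists_mkₐ_comp_eq_of_isAdicComplete ψ'
  exact ⟨g.toRingHom, RingHom.ext fun x => g.commutes x,
    RingHom.ext fun x => AlgHom.congr_fun hg x⟩

end SmoothLifting

/-! ### Weights of functions under conjugation by a cocharacter. -/

section Dynamics

open LaurentPolynomial (C)

variable {k R : Type*} [CommRing k] [CommRing R] [HopfAlgebra k R]
variable {B B' : Type*} [CommRing B] [Algebra k B] [CommRing B'] [Algebra k B']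
variable (η : R →ₐc[k] k[T;T⁻¹])

theorem Points.map_injective {φ : B →ₐ[k] B'} (hφ : Function.Injective φ) :
    Function.Injective (Points.map (R := R) φ) := fun _ _ H =>
  Points.ext fun f => hφ (congr_arg (fun x => x.eval f) H)

theorem Points.map_mem_closedSubgroup (φ : B →ₐ[k] B') (I : Ideal R) [I.IsHopfIdeal k]
    {g : Points k R B} (hg : g ∈ closedSubgroup I B) : Points.map φ g ∈ closedSubgroup I B' := by
  intro f hf
  rw [Points.map_eval, hg f hf, map_zero]

theorem laurent_algHom_ext {φ ψ : k[T;T⁻¹] →ₐ[k] B}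
    (h : ∀ m, φ (LaurentPolynomial.T m) = ψ (LaurentPolynomial.T m)) : φ = ψ := by
  apply AlgHom.ext
  intro x
  induction x using LaurentPolynomial.induction_on' with
  | add x y hx hy => rw [map_add, map_add, hx, hy]
  | C_mul_T m a =>
    rw [← LaurentPolynomial.smul_eq_C_mul, map_smul, map_smul, h]

theorem laurentEval_T (t : Bˣ) (m : ℤ) :
    laurentEval t (LaurentPolynomial.T m : k[T;T⁻¹]) = (t ^ m : Bˣ) :=
  LaurentPolynomial.eval₂_T _ _ _

theorem laurentEval_C_mul_T (t : Bˣ) (a : k) (m : ℤ) :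
    laurentEval t (C a * LaurentPolynomial.T m : k[T;T⁻¹]) = algebraMap k B a * (t ^ m : Bˣ) :=
  LaurentPolynomial.eval₂_C_mul_T _ _ _ _

theorem map_cocharAt (φ : B →ₐ[k] B') (t : Bˣ) :
    Points.map φ (cocharAt η t) = cocharAt η (Units.map (φ : B →* B') t) := by
  have h : φ.comp (laurentEval t) = laurentEval (k := k) (Units.map (φ : B →* B') t) := by
    apply laurent_algHom_ext
    intro m
    rw [AlgHom.comp_apply, laurentEval_T, laurentEval_T, ← map_zpow]
    rfl
  ext f
  exact AlgHom.congr_fun h (η f)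

theorem cocharAt_one : cocharAt η (1 : Bˣ) = 1 := by
  have h : (laurentEval (1 : Bˣ) : k[T;T⁻¹] →ₐ[k] B) =
      (Algebra.ofId k B).comp (Bialgebra.counitAlgHom k k[T;T⁻¹]) := by
    apply laurent_algHom_ext
    intro m
    rw [laurentEval_T, AlgHom.comp_apply, Bialgebra.counitAlgHom_apply,
      LaurentPolynomial.counit_T]
    simp
  ext f
  change laurentEval (1 : Bˣ) (η f) = algebraMap k B (Coalgebra.counit f)
  rw [h]
  simp [Algebra.ofId_apply]

/-- Each `T ^ m` is group-like. This makes `cocharAt η` multiplicative. -/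
theorem laurentEval_mul (s t : Bˣ) :
    (laurentEval (s * t) : k[T;T⁻¹] →ₐ[k] B) =
      (Algebra.TensorProduct.lift (laurentEval s) (laurentEval t) fun _ _ => Commute.all _ _).comp
        (Bialgebra.comulAlgHom k k[T;T⁻¹]) := by
  apply laurent_algHom_ext
  intro m
  rw [AlgHom.comp_apply, Bialgebra.comulAlgHom_apply, LaurentPolynomial.comul_T,
    Algebra.TensorProduct.lift_tmul, laurentEval_T, laurentEval_T, laurentEval_T, mul_zpow,
    Units.val_mul]

theorem cocharAt_mul (s t : Bˣ) : cocharAt η (s * t) = cocharAt η s * cocharAt η t := by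
  have h : Algebra.TensorProduct.lift (cocharAt η s).ofConv (cocharAt η t).ofConv
      (fun _ _ => Commute.all _ _) =
      (Algebra.TensorProduct.lift (laurentEval s) (laurentEval t) fun _ _ => Commute.all _ _).comp
        (Algebra.TensorProduct.map (η : R →ₐ[k] k[T;T⁻¹]) (η : R →ₐ[k] k[T;T⁻¹])) := by
    ext x
    · simp; rfl
    · simp; rfl
  ext f
  rw [Points.mul_eval, h, AlgHom.comp_apply]
  refine (AlgHom.congr_fun (laurentEval_mul s t) (η f)).trans ?_
  exact congr_arg _ (CoalgHomClass.map_comp_comul_apply η f).symm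

/-- A cocharacter as a homomorphism on points. -/
noncomputable def cocharHom : Bˣ →* Points k R B where
  toFun := cocharAt η
  map_one' := cocharAt_one η
  map_mul' := cocharAt_mul η

theorem map_cocharHom (φ : B →ₐ[k] B') (t : Bˣ) :
    Points.map φ (cocharHom η t) = cocharHom η (Units.map (φ : B →* B') t) :=
  map_cocharAt η φ t

theorem conjCochar_apply (m : ℤ) (g : Points k R B) :
    conjCochar B η m g = cocharHom η (unitT B m) * Points.map (constHom k B) g *
      (cocharHom η (unitT B m))⁻¹ := rfl

theorem unitT_eq_zpow (m : ℤ) : unitT B m = unitT B 1 ^ m := by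
  let φ : Multiplicative ℤ →* (B[T;T⁻¹])ˣ :=
    { toFun := fun m => unitT B m.toAdd
      map_one' := by ext1; simp [unitT]
      map_mul' := fun a b => Units.ext (LaurentPolynomial.T_add _ _) }
  have := map_zpow φ (Multiplicative.ofAdd 1) m
  rw [← ofAdd_zsmul] at this
  simpa [φ] using this

/-- The substitution `T ↦ s T` in Laurent polynomials over `B`. -/
noncomputable def scaleHom (s : Bˣ) : B[T;T⁻¹] →ₐ[B] B[T;T⁻¹] :=
  laurentEval (Units.map (C : B →+* B[T;T⁻¹]).toMonoidHom s * unitT B 1)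

/-- The evaluation of Laurent polynomials over `B` at `s`. -/
noncomputable def evalHom (s : Bˣ) : B[T;T⁻¹] →ₐ[B] B := laurentEval s

theorem evalHom_eq_sum (s : Bˣ) (x : B[T;T⁻¹]) :
    evalHom s x = x.coeff.sum fun m a => a * (s ^ m : Bˣ) := by
  conv_lhs => rw [← AddMonoidAlgebra.sum_coeff_single x, Finsupp.sum, map_sum]
  refine Finset.sum_congr rfl fun m _ => ?_
  rw [LaurentPolynomial.single_eq_C_mul_T]
  exact laurentEval_C_mul_T s _ m

theorem coeff_scaleHom (s : Bˣ) (x : B[T;T⁻¹]) (m : ℤ) :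
    (scaleHom s x).coeff m = (s ^ m : Bˣ) * x.coeff m := by
  induction x using LaurentPolynomial.induction_on' with
  | add x y hx hy => simp [hx, hy, mul_add]
  | C_mul_T n a =>
    have : scaleHom s (C a * LaurentPolynomial.T n) =
        C a * (C ((s ^ n : Bˣ) : B) * LaurentPolynomial.T n) := by
      refine (laurentEval_C_mul_T _ a n).trans ?_
      rw [mul_zpow, ← unitT_eq_zpow, Units.val_mul, ← map_zpow]
      rfl
    rw [this, ← mul_assoc, ← map_mul, ← LaurentPolynomial.single_eq_C_mul_T,
      ← LaurentPolynomial.single_eq_C_mul_T]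
    by_cases h : n = m
    · subst h
      rw [AddMonoidAlgebra.coeff_single, AddMonoidAlgebra.coeff_single, Finsupp.single_eq_same,
        Finsupp.single_eq_same, mul_comm]
    · rw [AddMonoidAlgebra.coeff_single, AddMonoidAlgebra.coeff_single,
        Finsupp.single_eq_of_ne' h, Finsupp.single_eq_of_ne' h, mul_zero]

/-- Since `η(s) η(T) = η(sT)`, conjugating first by `η(s)⁻¹` amounts to the substitution `T ↦ sT`,
so weight `m` is scaled by `s ^ m`. -/
theorem conjCochar_neg_one_conj (s : Bˣ) (g : Points k R B) :
    conjCochar B η (-1) ((cocharHom η s)⁻¹ * g * cocharHom η s) =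
      Points.map ((scaleHom s).restrictScalars k) (conjCochar B η (-1) g) := by
  have h1 : Units.map (((scaleHom s).restrictScalars k : B[T;T⁻¹] →ₐ[k] B[T;T⁻¹]) :
      B[T;T⁻¹] →* B[T;T⁻¹]) (unitT B 1) =
      Units.map (constHom k B : B →* B[T;T⁻¹]) s * unitT B 1 := by
    ext1
    refine (laurentEval_T _ 1).trans ?_
    rw [zpow_one]
    rfl
  have h2 : Points.map ((scaleHom s).restrictScalars k) (Points.map (constHom k B) g) =
      Points.map (constHom k B) g := by
    ext1 f
    exact (scaleHom s).commutes (g.eval f)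
  simp only [conjCochar_apply, map_mul, map_inv, h2, map_cocharHom, unitT_eq_zpow (-1), h1,
    zpow_neg, zpow_one]
  group

theorem map_evalHom_conjCochar (s : Bˣ) (g : Points k R B) :
    Points.map ((evalHom s).restrictScalars k) (conjCochar B η (-1) g) =
      (cocharHom η s)⁻¹ * g * cocharHom η s := by
  have h1 : Units.map (((evalHom s).restrictScalars k : B[T;T⁻¹] →ₐ[k] B) :
      B[T;T⁻¹] →* B) (unitT B 1) = s := by
    ext1
    refine (laurentEval_T _ 1).trans ?_
    rw [zpow_one]
  have h2 : Points.map ((evalHom s).restrictScalars k) (Points.map (constHom k B) g) = g := by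
    ext f
    exact (evalHom s).commutes (g.eval f)
  simp only [conjCochar_apply, map_mul, map_inv, h2, map_cocharHom, unitT_eq_zpow (-1), h1,
    zpow_neg, zpow_one]
  group

theorem conjCochar_neg_one_of_mem_dynLevi {g : Points k R B} (hg : g ∈ dynLevi B η) :
    conjCochar B η (-1) g = Points.map (constHom k B) g := by
  have h : conjCochar B η 1 g = Points.map (constHom k B) g := hg
  rw [conjCochar_apply] at h ⊢
  rw [unitT_eq_zpow (-1), zpow_neg, zpow_one, map_inv, inv_inv]
  nth_rw 1 [← h]
  group

/-- The coefficients at `g` are the values at `g` of the coefficients of the universal point, whose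
negative ones generate `dynParabolicIdeal`. -/
theorem mem_dynParabolic_iff_coeff (n : ℤ) (g : Points k R B) :
    g ∈ dynParabolic B η n ↔
      ∀ (f : R) (m : ℤ), m < 0 → ((conjCochar B η n g).eval f).coeff m = 0 := by
  have h1 : ∀ (f : R) (m : ℤ), ((conjCochar B η n g).eval f).coeff m =
      g.eval (((conjCochar R η n (Points.mk (AlgHom.id k R))).eval f).coeff m) := by
    intro f m
    have h2 : g = Points.map g.ofConv (Points.mk (AlgHom.id k R)) := rfl
    conv_lhs => rw [h2, conjCochar_map, Points.map_eval, coeff_laurentMap]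
    rfl
  rw [mem_dynParabolic_iff]
  constructor
  · intro h f m hm
    rw [h1]
    exact h _ (Ideal.subset_span ⟨f, m, hm, rfl⟩)
  · intro h
    have hker : dynParabolicIdeal η n ≤ RingHom.ker g.ofConv := by
      refine Ideal.span_le.2 ?_
      rintro _ ⟨f, m, hm, rfl⟩
      exact (h1 f m).symm.trans (h f m hm)
    exact fun c hc => hker hc

/-- The points `g` for which `lim_{t → 0} η(t)ⁿ g η(t)⁻ⁿ` exists and lies in the closed subgroup
defined by `I`. -/
noncomputable def dynLimit (B : Type*) [CommRing B] [Algebra k B] (n : ℤ) (I : Ideal R) [I.IsHopfIdeal k] :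
    Subgroup (Points k R B) :=
  (((closedSubgroup I B).comap (Points.map (zeroHom k B))).map
    (Points.map (polyHom k B))).comap (conjCochar B η n)

theorem mem_dynLimit_iff (n : ℤ) (I : Ideal R) [I.IsHopfIdeal k] (g : Points k R B) :
    g ∈ dynLimit η B n I ↔ g ∈ dynParabolic B η n ∧
      ∀ f ∈ I, ((conjCochar B η n g).eval f).coeff 0 = 0 := by
  -- The limit is the value of the polynomial point at `X = 0`, which is read off from constant
  -- coefficients.
  have h0 : ∀ (β : Points k R B[X]) (f : R),
      ((Points.map (polyHom k B) β).eval f).coeff 0 = (Points.map (zeroHom k B) β).eval f := by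
    intro β f
    rw [Points.map_eval, Points.map_eval]
    generalize β.eval f = q
    change (Polynomial.toLaurent q).coeff 0 = Polynomial.aeval (0 : B) q
    rw [← Polynomial.coeff_zero_eq_aeval_zero]
    induction q using Polynomial.induction_on' with
    | add q q' hq hq' =>
      rw [map_add, Polynomial.coeff_add, ← hq, ← hq']
      rfl
    | monomial m a =>
      rw [Polynomial.toLaurent_C_mul_T, ← LaurentPolynomial.single_eq_C_mul_T,
        AddMonoidAlgebra.coeff_single, Polynomial.coeff_monomial, Finsupp.single_apply]
      simp
  constructor
  · rintro ⟨β, hβ, h⟩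
    exact ⟨⟨β, h⟩, fun f hf => by rw [← h, h0]; exact hβ f hf⟩
  · rintro ⟨⟨β, h⟩, hg⟩
    exact ⟨β, fun f hf => by rw [← h0, h]; exact hg f hf, h⟩

/-- A point `g` with limit `l` in the closed subgroup factors as `(g l⁻¹) l`. Because `l`
centralises `η`, it is its own limit, so `g l⁻¹` has limit `1`. This replaces the join defining
`Q̄_G⁰` by equations on weight coefficients. -/
theorem dynUnipotent_sup_closedSubgroup (I : Ideal R) [I.IsHopfIdeal k]
    (hI : closedSubgroup I B ≤ dynLevi B η) :
    dynUnipotent B η (-1) ⊔ closedSubgroup I B = dynLimit η B (-1) I := by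
  have hconst : ∀ g : Points k R B, Points.map (polyHom k B)
      (Points.map (Algebra.ofId B B[X] |>.restrictScalars k) g) = Points.map (constHom k B) g := by
    intro g
    ext1 f
    exact Polynomial.toLaurent_C (g.eval f)
  have hzero : ∀ g : Points k R B, Points.map (zeroHom k B)
      (Points.map (Algebra.ofId B B[X] |>.restrictScalars k) g) = g := by
    intro g
    ext1 f
    exact Polynomial.aeval_C (0 : B) (g.eval f)
  apply le_antisymm
  · refine sup_le (Subgroup.comap_mono (Subgroup.map_mono fun β hβ => ?_)) fun l hl => ?_
    · rw [MonoidHom.mem_ker] at hβ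
      rw [Subgroup.mem_comap, hβ]
      exact Subgroup.one_mem _
    · refine ⟨_, ?_, (hconst l).trans (conjCochar_neg_one_of_mem_dynLevi η (hI hl)).symm⟩
      rw [SetLike.mem_coe, Subgroup.mem_comap, hzero]
      exact hl
  · rintro g ⟨β, hβ, hg⟩
    rw [SetLike.mem_coe, Subgroup.mem_comap] at hβ
    set l := Points.map (zeroHom k B) β with hl
    rw [← inv_mul_cancel_right g l]
    refine Subgroup.mul_mem_sup ⟨β * (Points.map (Algebra.ofId B B[X] |>.restrictScalars k) l)⁻¹,
      ?_, ?_⟩ hβ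
    · rw [SetLike.mem_coe, MonoidHom.mem_ker, map_mul, map_inv, hzero, ← hl, mul_inv_cancel]
    · rw [map_mul, map_inv, map_mul, map_inv, hg, hconst,
        conjCochar_neg_one_of_mem_dynLevi η (hI hβ)]

/-- The coefficient of `T ^ m` in `f(η(T)⁻¹ g η(T))`. -/
noncomputable def dynCoeff (g : Points k R B) (f : R) (m : ℤ) : B :=
  ((conjCochar B η (-1) g).eval f).coeff m

theorem dynCoeff_map (φ : B →ₐ[k] B') (g : Points k R B) (f : R) (m : ℤ) :
    dynCoeff η (Points.map φ g) f m = φ (dynCoeff η g f m) := by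
  rw [dynCoeff, conjCochar_map, Points.map_eval, coeff_laurentMap]
  rfl

theorem dynCoeff_conj (s : Bˣ) (g : Points k R B) (f : R) (m : ℤ) :
    dynCoeff η ((cocharHom η s)⁻¹ * g * cocharHom η s) f m = (s ^ m : Bˣ) * dynCoeff η g f m := by
  rw [dynCoeff, conjCochar_neg_one_conj]
  exact coeff_scaleHom s _ m

/-- Specialising `T` to `s` recovers the conjugate from its finitely many weight components. -/
theorem eval_conj_eq_sum (s : Bˣ) (g : Points k R B) (f : R) :
    ((cocharHom η s)⁻¹ * g * cocharHom η s).eval f =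
      ((conjCochar B η (-1) g).eval f).coeff.support.sum
        fun m => dynCoeff η g f m * (s ^ m : Bˣ) := by
  rw [← map_evalHom_conjCochar]
  exact evalHom_eq_sum s _

end Dynamics

/-! ### The groups `U_r` in terms of weight coefficients. -/

namespace GroupDatum

variable {p : ℕ} [Fact p.Prime] (D : GroupDatum p)

theorem norm_unitP_pow_zpow (r : ℕ) (m : ℤ) :
    ‖((((unitP : (ℚ_[p])ˣ) ^ r) ^ m : (ℚ_[p])ˣ) : ℚ_[p])‖ = (p : ℝ) ^ (-(r * m : ℤ)) := by
  rw [← zpow_natCast, ← zpow_mul, Units.val_zpow_eq_zpow_val]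
  exact Padic.norm_p_zpow _

theorem tau_pow (r : ℕ) : D.tau ^ r = cocharHom D.η (unitP ^ r) := by
  rw [map_pow]
  rfl

theorem inclQp_injective {R : Type*} [CommRing R] [HopfAlgebra ℤ_[p] R] :
    Function.Injective (inclQp : Points ℤ_[p] R ℤ_[p] → _) :=
  Points.map_injective Subtype.coe_injective

theorem dynCoeff_inclQp (g : Points ℤ_[p] D.R ℤ_[p]) (f : D.R) (m : ℤ) :
    dynCoeff D.η (inclQp g) f m = ((dynCoeff D.η g f m : ℤ_[p]) : ℚ_[p]) :=
  dynCoeff_map D.η _ g f m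

variable {D}

theorem dynCoeff_of_conj_tau {r : ℕ} {g x : Points ℤ_[p] D.R ℤ_[p]}
    (hx : inclQp x = (D.tau ^ r)⁻¹ * inclQp g * D.tau ^ r) (f : D.R) (m : ℤ) :
    ((dynCoeff D.η x f m : ℤ_[p]) : ℚ_[p]) =
      ((((unitP : (ℚ_[p])ˣ) ^ r) ^ m : (ℚ_[p])ˣ) : ℚ_[p]) *
        (dynCoeff D.η g f m : ℤ_[p]) := by
  rw [← dynCoeff_inclQp, ← dynCoeff_inclQp, hx, tau_pow, dynCoeff_conj]

/-- The element `τ⁻ʳ g τʳ` is integral if and only if the functions of weight `m` on `G` take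
values in `p ^ (-r m) ℤ_p` at `g`. -/
theorem conj_tau_mem_GZp_iff (r : ℕ) (g : Points ℤ_[p] D.R ℤ_[p]) :
    (D.tau ^ r)⁻¹ * inclQp g * D.tau ^ r ∈ D.GZp ↔
      ∀ (f : D.R) (m : ℤ), (p : ℝ) ^ (-(r * m : ℤ)) * ‖dynCoeff D.η g f m‖ ≤ 1 := by
  constructor
  · rintro ⟨x, hx⟩ f m
    have h := congr_arg norm (dynCoeff_of_conj_tau hx f m)
    rw [norm_mul, norm_unitP_pow_zpow] at h
    exact h.symm.trans_le (PadicInt.norm_le_one _)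
  · intro h
    refine mem_range_inclQp Set.univ (Algebra.adjoin_univ _ _) fun f _ => ?_
    rw [tau_pow, eval_conj_eq_sum]
    -- The value of `f` is a finite sum of weight components, so it suffices to bound each term by
    -- the ultrametric inequality.
    refine IsUltrametricDist.norm_sum_le_of_forall_le_of_nonneg zero_le_one fun m _ => ?_
    rw [norm_mul, norm_unitP_pow_zpow, mul_comm, dynCoeff_inclQp]
    exact h f m

/-- In weights `m ≥ 0` the bound is automatic for integral `g`; in weights `m ≤ 0` it gets stronger
as the exponent grows. -/
theorem conj_tau_mem_GZp_of_le {r s : ℕ} (hs : s ≤ r) {g : Points ℤ_[p] D.R ℤ_[p]}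
    (hg : (D.tau ^ r)⁻¹ * inclQp g * D.tau ^ r ∈ D.GZp) :
    (D.tau ^ s)⁻¹ * inclQp g * D.tau ^ s ∈ D.GZp := by
  rw [conj_tau_mem_GZp_iff] at hg ⊢
  intro f m
  have hp : (1 : ℝ) ≤ p := Nat.one_le_cast.2 (Fact.out : p.Prime).one_le
  have hs' : (s : ℤ) ≤ r := Nat.cast_le.2 hs
  rcases le_total 0 m with hm | hm
  · exact mul_le_one₀ (zpow_le_one_of_nonpos₀ hp (by simpa using mul_nonneg s.cast_nonneg hm))
      (norm_nonneg _) (PadicInt.norm_le_one _)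
  · refine le_trans (mul_le_mul_of_nonneg_right (zpow_le_zpow_right₀ hp ?_) (norm_nonneg _))
      (hg f m)
    nlinarith

/-- On `Q̄_G` the negative weight coefficients vanish, and the other weights impose no condition. -/
theorem conj_tau_mem_GZp_of_mem_dynParabolic (r : ℕ) {g : Points ℤ_[p] D.R ℤ_[p]}
    (hg : g ∈ dynParabolic ℤ_[p] D.η (-1)) :
    (D.tau ^ r)⁻¹ * inclQp g * D.tau ^ r ∈ D.GZp := by
  rw [mem_dynParabolic_iff_coeff] at hg
  rw [conj_tau_mem_GZp_iff]
  intro f m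
  have hp : (1 : ℝ) ≤ p := Nat.one_le_cast.2 (Fact.out : p.Prime).one_le
  rcases le_or_gt 0 m with hm | hm
  · exact mul_le_one₀ (zpow_le_one_of_nonpos₀ hp (by simpa using mul_nonneg r.cast_nonneg hm))
      (norm_nonneg _) (PadicInt.norm_le_one _)
  · rw [dynCoeff, hg f m hm, norm_zero, mul_zero]
    exact zero_le_one

/-- A coefficient of weight `m ≤ -1` is divisible by `p ^ (-r m)`, hence by `p ^ r`. -/
theorem redMod_mem_dynParabolic {r : ℕ} {g : Points ℤ_[p] D.R ℤ_[p]}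
    (hg : (D.tau ^ r)⁻¹ * inclQp g * D.tau ^ r ∈ D.GZp) :
    redMod r g ∈ dynParabolic (ℤ_[p] ⧸ Ideal.span {(p : ℤ_[p]) ^ r}) D.η (-1) := by
  rw [conj_tau_mem_GZp_iff] at hg
  rw [mem_dynParabolic_iff_coeff]
  intro f m hm
  refine (dynCoeff_map D.η (Ideal.Quotient.mkₐ ℤ_[p] _) g f m).trans ?_
  refine Ideal.Quotient.eq_zero_iff_mem.2 ?_
  rw [← PadicInt.norm_le_pow_iff_mem_span_pow]
  have hp : (1 : ℝ) ≤ p := Nat.one_le_cast.2 (Fact.out : p.Prime).one_le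
  have hp0 : (0 : ℝ) < p := zero_lt_one.trans_le hp
  have h1 : (p : ℝ) ^ (r : ℤ) * ‖dynCoeff D.η g f m‖ ≤ 1 := by
    refine le_trans (mul_le_mul_of_nonneg_right (zpow_le_zpow_right₀ hp ?_) (norm_nonneg _))
      (hg f m)
    nlinarith [(Nat.cast_nonneg r : (0 : ℤ) ≤ r)]
  rwa [zpow_neg, ← one_div, le_div_iff₀' (zpow_pos hp0 _)]

theorem Qbar0_eq_dynLimit (B : Type) [CommRing B] [Algebra ℤ_[p] B] :
    D.Qbar0 B = dynLimit D.η B (-1) D.idealL :=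
  dynUnipotent_sup_closedSubgroup D.η D.idealL (D.L_le B)

theorem Qbar0_le (B : Type) [CommRing B] [Algebra ℤ_[p] B] :
    D.Qbar0 B ≤ dynParabolic B D.η (-1) := by
  intro g hg
  rw [Qbar0_eq_dynLimit, mem_dynLimit_iff] at hg
  exact hg.1

theorem inclQp_mem_Ugrp_iff {r : ℕ} {g : Points ℤ_[p] D.R ℤ_[p]} :
    inclQp g ∈ D.Ugrp r ↔ (D.tau ^ r)⁻¹ * inclQp g * D.tau ^ r ∈ D.GZp ∧
      redMod r g ∈ D.Qbar0 (ℤ_[p] ⧸ Ideal.span {(p : ℤ_[p]) ^ r}) := by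
  rw [and_comm, Ugrp, Subgroup.mem_inf, mem_conjSubgroup, inv_inv,
    Subgroup.mem_map_iff_mem inclQp_injective, Subgroup.mem_comap]

/-- Integrality of `τ⁻ʳ g τʳ` already puts the reduction in `Q̄_G`, so only the condition that its
limit lies in `L_G⁰` remains, and that is a congruence in weight zero. -/
theorem inclQp_mem_Ugrp_iff_dvd {r : ℕ} {g : Points ℤ_[p] D.R ℤ_[p]} :
    inclQp g ∈ D.Ugrp r ↔ (D.tau ^ r)⁻¹ * inclQp g * D.tau ^ r ∈ D.GZp ∧
      ∀ f ∈ D.idealL, (p : ℤ_[p]) ^ r ∣ dynCoeff D.η g f 0 := by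
  rw [inclQp_mem_Ugrp_iff]
  refine and_congr_right fun h => ?_
  rw [Qbar0_eq_dynLimit, mem_dynLimit_iff, and_iff_right (redMod_mem_dynParabolic h)]
  refine forall₂_congr fun f _ => ?_
  have h1 := dynCoeff_map D.η (Ideal.Quotient.mkₐ ℤ_[p] (Ideal.span {(p : ℤ_[p]) ^ r})) g f 0
  rw [← Ideal.mem_span_singleton, ← Ideal.Quotient.eq_zero_iff_mem]
  exact ⟨fun h => h1.symm.trans h, fun h => h1.trans h⟩

theorem exists_inclQp_of_mem_Ugrp {r : ℕ} {g : D.GQp} (hg : g ∈ D.Ugrp r) :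
    ∃ x : Points ℤ_[p] D.R ℤ_[p], inclQp x = g := D.Ugrp_le r hg

theorem Ugrp_succ_le (r : ℕ) : D.Ugrp (r + 1) ≤ D.Ugrp r := by
  intro g hg
  obtain ⟨g, rfl⟩ := exists_inclQp_of_mem_Ugrp hg
  rw [inclQp_mem_Ugrp_iff_dvd] at hg ⊢
  exact ⟨conj_tau_mem_GZp_of_le r.le_succ hg.1,
    fun f hf => (pow_dvd_pow _ r.le_succ).trans (hg.2 f hf)⟩

/-- Conjugation by `τ` shifts the exponent in the integrality condition by one but fixes weight
zero. Hence a congruence modulo `p ^ r`, rather than `p ^ (r+1)`, is enough. -/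
theorem conj_tau_mem_Ugrp {r : ℕ} {g : Points ℤ_[p] D.R ℤ_[p]}
    (hg : (D.tau ^ (r + 1))⁻¹ * inclQp g * D.tau ^ (r + 1) ∈ D.GZp)
    (hg' : ∀ f ∈ D.idealL, (p : ℤ_[p]) ^ r ∣ dynCoeff D.η g f 0) :
    D.tau⁻¹ * inclQp g * D.tau ∈ D.Ugrp r := by
  have h1 := conj_tau_mem_GZp_of_le (Nat.le_add_left 1 r) hg
  obtain ⟨x, hx⟩ := h1
  have hx' : inclQp x = D.tau⁻¹ * inclQp g * D.tau := by rw [hx, pow_one]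
  rw [← hx', inclQp_mem_Ugrp_iff_dvd]
  constructor
  · rw [hx']
    convert hg using 1
    rw [pow_succ']
    group
  · intro f hf
    have h2 := dynCoeff_of_conj_tau hx f 0
    rw [zpow_zero, Units.val_one, one_mul] at h2
    rw [show dynCoeff D.η x f 0 = dynCoeff D.η g f 0 from Subtype.ext h2]
    exact hg' f hf

theorem isArrow_tau (r : ℕ) : IsArrow D.tau (D.Ugrp (r + 1)) (D.Ugrp r) := by
  intro g hg
  obtain ⟨g, rfl⟩ := exists_inclQp_of_mem_Ugrp hg
  rw [inclQp_mem_Ugrp_iff_dvd] at hg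
  exact conj_tau_mem_Ugrp hg.1 fun f hf => (pow_dvd_pow _ r.le_succ).trans (hg.2 f hf)

theorem mem_Ugrp_inf_conj_tau {r : ℕ} {g : D.GQp} :
    g ∈ D.Ugrp r ⊓ conjSubgroup D.tau⁻¹ (D.Ugrp r) ↔
      g ∈ D.Ugrp r ∧ D.tau⁻¹ * g * D.tau ∈ D.Ugrp r := by
  rw [Subgroup.mem_inf, mem_conjSubgroup, inv_inv]

theorem Ugrp_succ_le_inf (r : ℕ) :
    D.Ugrp (r + 1) ≤ D.Ugrp r ⊓ conjSubgroup D.tau⁻¹ (D.Ugrp r) := fun g hg =>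
  mem_Ugrp_inf_conj_tau.2 ⟨Ugrp_succ_le r hg, isArrow_tau r g hg⟩

/-! ### Consequences of conditions (A) and (B) for integral points. -/

/-- Under condition (B), a point of `u⁻¹ Q_H⁰ u` in `U_r ∩ τ U_r τ⁻¹` lies in `U_{r+1}`. -/
theorem mem_Ugrp_succ_of_conditionB (hB : D.ConditionB) {r : ℕ} {q : Points ℤ_[p] D.R ℤ_[p]}
    (hq : q ∈ closedSubgroup D.idealQ ℤ_[p])
    (h : inclQp (D.u⁻¹ * q * D.u) ∈ D.Ugrp r ⊓ conjSubgroup D.tau⁻¹ (D.Ugrp r)) :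
    inclQp (D.u⁻¹ * q * D.u) ∈ D.Ugrp (r + 1) := by
  rw [mem_Ugrp_inf_conj_tau] at h
  have h1 : (D.tau ^ (r + 1))⁻¹ * inclQp (D.u⁻¹ * q * D.u) * D.tau ^ (r + 1) ∈ D.GZp := by
    have h2 := mem_conjSubgroup.1 h.2.2
    rw [inv_inv] at h2
    convert h2 using 1
    rw [pow_succ']
    group
  rw [inclQp_mem_Ugrp_iff]
  refine ⟨h1, ?_⟩
  -- The reduction lies in `Q̄_G` modulo `p ^ (r+1)`, one power more than membership in `U_r` gives,
  -- so (B) can be applied over `ℤ_p / p ^ (r+1)`.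
  have h2 := redMod_mem_dynParabolic h1
  have h3 := hB (ℤ_[p] ⧸ Ideal.span {(p : ℤ_[p]) ^ (r + 1)}) (redMod (r + 1) q)
    (Points.map_mem_closedSubgroup _ _ hq)
  have h4 : redMod (r + 1) D.u = Points.map (Algebra.ofId ℤ_[p] _) D.u := by
    unfold redMod
    congr 1
  rw [map_mul, map_mul, map_inv, h4] at h2 ⊢
  exact h3 h2

theorem map_orbitMap {B : Type} [CommRing B] [Algebra ℤ_[p] B] (Ψ : D.orbitRing →ₐ[ℤ_[p]] B) :
    Points.map Ψ D.orbitMap =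
      Points.mk ((Ψ.comp Algebra.TensorProduct.includeLeft).comp
        (Ideal.Quotient.mkₐ ℤ_[p] D.idealQ)) * Points.map (Algebra.ofId ℤ_[p] B) D.u *
      Points.mk ((Ψ.comp Algebra.TensorProduct.includeRight).comp
        (Ideal.Quotient.mkₐ ℤ_[p] (dynParabolicIdeal D.η (-1)))) := by
  rw [orbitMap, map_mul, map_mul]
  have : Points.map Ψ (Points.map (Algebra.ofId ℤ_[p] D.orbitRing) D.u) =
      Points.map (Algebra.ofId ℤ_[p] B) D.u := by
    ext f
    exact Ψ.commutes _
  rw [this]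
  rfl

/-- Under condition (A), a point of `u G(ℤ_p)` that is congruent to a point of `u Q̄_G` modulo
`p ^ r` lies in `Q_H⁰(ℤ_p) u Q̄_G(ℤ_p)`, with congruent second factor. -/
theorem exists_of_conditionA (hA : D.ConditionA) {r : ℕ} (hr : 1 ≤ r)
    {g : Points ℤ_[p] D.R ℤ_[p]}
    (hg : redMod r g ∈ dynParabolic (ℤ_[p] ⧸ Ideal.span {(p : ℤ_[p]) ^ r}) D.η (-1)) :
    ∃ q ∈ closedSubgroup D.idealQ ℤ_[p], ∃ b ∈ dynParabolic ℤ_[p] D.η (-1),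
      q * D.u * b = D.u * g ∧ redMod r b = redMod r g := by
  set J : Ideal ℤ_[p] := Ideal.span {(p : ℤ_[p]) ^ r} with hJ
  -- This uses `r ≥ 1`: for `r = 0` the ideal is the unit ideal.
  have : IsAdicComplete J ℤ_[p] := by
    rw [hJ, ← Ideal.span_singleton_pow, ← PadicInt.maximalIdeal_eq_span_p]
    exact isAdicComplete_pow _ hr
  -- Modulo `p ^ r` the pair `(1, g)` is a point of `Q_H⁰ × Q̄_G` mapping to `u g`; `ψ` is this
  -- point.
  let q₀ : D.R ⧸ D.idealQ →ₐ[ℤ_[p]] ℤ_[p] ⧸ J :=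
    Ideal.Quotient.liftₐ D.idealQ (1 : Points ℤ_[p] D.R (ℤ_[p] ⧸ J)).ofConv
      (Subgroup.one_mem (closedSubgroup D.idealQ (ℤ_[p] ⧸ J)))
  let b₀ : D.R ⧸ dynParabolicIdeal D.η (-1) →ₐ[ℤ_[p]] ℤ_[p] ⧸ J :=
    Ideal.Quotient.liftₐ _ (redMod r g).ofConv ((mem_dynParabolic_iff D.η (-1) _).1 hg)
  let ψ : D.orbitRing →ₐ[ℤ_[p]] ℤ_[p] ⧸ J :=
    Algebra.TensorProduct.lift q₀ b₀ fun _ _ => Commute.all _ _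
  have hq₀ : (Points.mk ((ψ.comp Algebra.TensorProduct.includeLeft).comp
      (Ideal.Quotient.mkₐ ℤ_[p] D.idealQ)) : Points ℤ_[p] D.R (ℤ_[p] ⧸ J)) = 1 := by
    rw [Algebra.TensorProduct.lift_comp_includeLeft]
    rfl
  have hb₀ : (Points.mk ((ψ.comp Algebra.TensorProduct.includeRight).comp
      (Ideal.Quotient.mkₐ ℤ_[p] (dynParabolicIdeal D.η (-1)))) :
        Points ℤ_[p] D.R (ℤ_[p] ⧸ J)) = redMod r g := by
    have : ψ.comp Algebra.TensorProduct.includeRight = b₀ :=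
      Algebra.TensorProduct.lift_comp_includeRight q₀ b₀ fun _ _ => Commute.all _ _
    rw [this]
    rfl
  have hu : redMod r D.u = Points.map (Algebra.ofId ℤ_[p] (ℤ_[p] ⧸ J)) D.u := by
    unfold redMod
    congr 1
  have hψ : Points.map ψ D.orbitMap = redMod r (D.u * g) := by
    rw [map_orbitMap, hq₀, hb₀, map_mul, hu, one_mul]
  -- The lift of `ψ` lies over the integral point `u g`, so `q u b = u g` holds exactly and not only
  -- modulo `p ^ r`.
  obtain ⟨Ψ, hΨ, hΨ'⟩ := exists_lift_of_smooth hA J ((D.u * g).ofConv : D.R →+* ℤ_[p])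
    (ψ : D.orbitRing →+* ℤ_[p] ⧸ J)
    (RingHom.ext fun f => congr_arg (fun x => x.eval f) hψ)
  -- The lift is `ℤ_p`-linear because `ℤ_p → orbitRing` factors through `orbitMap`, over which `Ψ`
  -- is the point `u g`.
  let Φ : D.orbitRing →ₐ[ℤ_[p]] ℤ_[p] :=
    { Ψ with
      commutes' := fun c => by
        have h1 := RingHom.congr_fun hΨ (algebraMap ℤ_[p] D.R c)
        have h2 : D.orbitMap.ofConv (algebraMap ℤ_[p] D.R c) = algebraMap ℤ_[p] _ c :=
          AlgHom.commutes _ c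
        have h3 : (D.u * g).ofConv (algebraMap ℤ_[p] D.R c) = c := AlgHom.commutes _ c
        refine Eq.trans (congr_arg Ψ h2.symm) (h1.trans h3) }
  have hΦ : Points.map Φ D.orbitMap = D.u * g := by
    ext1 f
    exact RingHom.congr_fun hΨ f
  have hΦ' : (Ideal.Quotient.mkₐ ℤ_[p] J).comp Φ = ψ := AlgHom.ext fun x => RingHom.congr_fun hΨ' x
  refine ⟨Points.mk ((Φ.comp Algebra.TensorProduct.includeLeft).comp
      (Ideal.Quotient.mkₐ ℤ_[p] D.idealQ)), fun f hf => ?_,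
    Points.mk ((Φ.comp Algebra.TensorProduct.includeRight).comp
      (Ideal.Quotient.mkₐ ℤ_[p] (dynParabolicIdeal D.η (-1)))),
    (mem_dynParabolic_iff D.η (-1) _).2 fun f hf => ?_, ?_, ?_⟩
  · change Φ (Ideal.Quotient.mk D.idealQ f ⊗ₜ 1) = 0
    rw [Ideal.Quotient.eq_zero_iff_mem.2 hf, TensorProduct.zero_tmul, map_zero]
  · change Φ (1 ⊗ₜ Ideal.Quotient.mk (dynParabolicIdeal D.η (-1)) f) = 0
    rw [Ideal.Quotient.eq_zero_iff_mem.2 hf, TensorProduct.tmul_zero, map_zero]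
  · rw [← hΦ, map_orbitMap]
    rfl
  · rw [← hb₀, ← hΦ']
    rfl

/-- Under condition (A), `U_r = (U_r ∩ τ U_r τ⁻¹) (U_r ∩ u⁻¹ Q_H⁰(ℤ_p) u)`. -/
theorem exists_mul_of_conditionA (hA : D.ConditionA) {r : ℕ} (hr : 1 ≤ r) {g : D.GQp}
    (hg : g ∈ D.Ugrp r) :
    ∃ a ∈ D.Ugrp r ⊓ conjSubgroup D.tau⁻¹ (D.Ugrp r),
      ∃ q ∈ closedSubgroup D.idealQ ℤ_[p], g = a * inclQp (D.u⁻¹ * q * D.u) := by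
  obtain ⟨g, rfl⟩ := exists_inclQp_of_mem_Ugrp hg
  have hg2 := (inclQp_mem_Ugrp_iff.1 hg).2
  -- Working with `g⁻¹` puts the factor from `Q̄_G` on the left: `u g⁻¹ = q u b` gives `g = b⁻¹ (u⁻¹
  -- q⁻¹ u)`.
  have h1 : redMod r g⁻¹ ∈ dynParabolic (ℤ_[p] ⧸ Ideal.span {(p : ℤ_[p]) ^ r}) D.η (-1) := by
    rw [map_inv]
    exact Subgroup.inv_mem _ (Qbar0_le _ hg2)
  obtain ⟨q, hq, b, hb, hqb, hbg⟩ := exists_of_conditionA hA hr h1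
  have hb' := Subgroup.inv_mem _ hb
  -- Integrality is free on `Q̄_G(ℤ_p)`, and `b⁻¹ ≡ g` modulo `p ^ r` supplies the congruence.
  have hbU : inclQp b⁻¹ ∈ D.Ugrp r := by
    rw [inclQp_mem_Ugrp_iff]
    refine ⟨conj_tau_mem_GZp_of_mem_dynParabolic r hb', ?_⟩
    rw [map_inv, hbg, map_inv, inv_inv]
    exact hg2
  refine ⟨inclQp b⁻¹, mem_Ugrp_inf_conj_tau.2 ⟨hbU, ?_⟩, q⁻¹, Subgroup.inv_mem _ hq, ?_⟩
  · exact conj_tau_mem_Ugrp (conj_tau_mem_GZp_of_mem_dynParabolic (r + 1) hb')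
      (inclQp_mem_Ugrp_iff_dvd.1 hbU).2
  · rw [← map_mul]
    congr 1
    have h2 : g = (D.u⁻¹ * (q * D.u * b))⁻¹ := by
      rw [hqb]
      group
    rw [h2]
    group

end GroupDatum

/-! ### Calculus of pushforwards, pullbacks and Hecke operators. -/

section Formalism

variable {G : Type*} [Group G] [TopologicalSpace G] {A : Type w} [CommRing A] {S : Submonoid G}

theorem LevelGroup.interConj_le [IsTopologicalGroup G] (U V : LevelGroup S) (g : G) :
    (U.interConj V g).grp ≤ U.grp := inf_le_left

theorem LevelGroup.isArrow_interConj [IsTopologicalGroup G] (U V : LevelGroup S) (g : G) :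
    IsArrow g (U.interConj V g).grp V.grp := isArrow_inter _ _ _

namespace CohomologyFunctor

variable (M : CohomologyFunctor.{v} A S)

theorem push_push {U V W : LevelGroup S} {g k : G} (hg : g⁻¹ ∈ S) (hk : k⁻¹ ∈ S)
    (hgk : (g * k)⁻¹ ∈ S) (h : IsArrow g U.grp V.grp) (h' : IsArrow k V.grp W.grp)
    (h'' : IsArrow (g * k) U.grp W.grp) (x : M.obj U) :
    M.push k hk h' (M.push g hg h x) = M.push (g * k) hgk h'' x :=
  (LinearMap.congr_fun (M.push_mul g k hg hk hgk h h' h'') x).symm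

theorem pull_pull {U V W : LevelGroup S} {g k : G} (hg : g ∈ S) (hk : k ∈ S)
    (hgk : g * k ∈ S) (h : IsArrow g U.grp V.grp) (h' : IsArrow k V.grp W.grp)
    (h'' : IsArrow (g * k) U.grp W.grp) (x : M.obj W) :
    M.pull g hg h (M.pull k hk h' x) = M.pull (g * k) hgk h'' x :=
  (LinearMap.congr_fun (M.pull_mul g k hg hk hgk h h' h'') x).symm

theorem push_eq_of_eq {U V : LevelGroup S} {g k : G} (hgk : g = k) (hg : g⁻¹ ∈ S) (hk : k⁻¹ ∈ S)
    (h : IsArrow g U.grp V.grp) (h' : IsArrow k U.grp V.grp) (x : M.obj U) :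
    M.push g hg h x = M.push k hk h' x := by
  subst hgk
  rfl

theorem pull_eq_of_eq {U V : LevelGroup S} {g k : G} (hgk : g = k) (hg : g ∈ S) (hk : k ∈ S)
    (h : IsArrow g U.grp V.grp) (h' : IsArrow k U.grp V.grp) (x : M.obj V) :
    M.pull g hg h x = M.pull k hk h' x := by
  subst hgk
  rfl

theorem prPull_prPull {U V W : LevelGroup S} (h : U.grp ≤ V.grp) (h' : V.grp ≤ W.grp)
    (x : M.obj W) : M.prPull h (M.prPull h' x) = M.prPull (h.trans h') x := by
  unfold prPull
  rw [M.pull_pull _ _ (by simp) _ _ ((isArrow_one h).mul (isArrow_one h'))]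
  exact M.pull_eq_of_eq (mul_one 1) _ _ _ _ x

theorem push_eq_pull_inv {U V : LevelGroup S} {g : G} (hg : g⁻¹ ∈ S) (h : IsArrow g U.grp V.grp)
    (h' : IsArrow g⁻¹ V.grp U.grp) (x : M.obj U) : M.push g hg h x = M.pull g⁻¹ hg h' x := by
  rw [M.pull_eq_push g⁻¹ hg (by simpa using hg) h' (by simpa using h)]
  exact M.push_eq_of_eq (inv_inv g).symm _ _ _ _ x

/-- Isomorphisms `[g]_⋆` commute with the restriction maps `pr^⋆`. -/
theorem prPull_push {U V U' V' : LevelGroup S} {g : G} (hg : g⁻¹ ∈ S)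
    (h : IsArrow g U.grp V.grp) (hinv : IsArrow g⁻¹ V.grp U.grp)
    (h' : IsArrow g U'.grp V'.grp) (hinv' : IsArrow g⁻¹ V'.grp U'.grp)
    (hU : U'.grp ≤ U.grp) (hV : V'.grp ≤ V.grp) (x : M.obj U) :
    M.prPull hV (M.push g hg h x) = M.push g hg h' (M.prPull hU x) := by
  have h1 : IsArrow g⁻¹ V'.grp U.grp := fun y hy => hU (hinv' y hy)
  -- For an isomorphism `[g]_⋆ = [g⁻¹]^⋆`, so the claim becomes contravariant functoriality.
  rw [M.push_eq_pull_inv hg h hinv, M.push_eq_pull_inv hg h' hinv']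
  unfold prPull
  rw [M.pull_pull _ _ (by simpa using hg) _ _ (by simpa using h1),
    M.pull_pull _ _ (by simpa using hg) _ _ (by simpa using h1)]
  exact M.pull_eq_of_eq (by simp) _ _ _ _ x

theorem push_prPush {U U' V : LevelGroup S} {g : G} (hg : g⁻¹ ∈ S) (hU : U.grp ≤ U'.grp)
    (h : IsArrow g U'.grp V.grp) (h' : IsArrow g U.grp V.grp) (x : M.obj U) :
    M.push g hg h (M.prPush hU x) = M.push g hg h' x := by
  unfold prPush
  rw [M.push_push _ _ (by simpa using hg) _ _ (by simpa using h')]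
  exact M.push_eq_of_eq (one_mul g) _ _ _ _ x

theorem prPush_push {U V V' : LevelGroup S} {g : G} (hg : g⁻¹ ∈ S) (hV : V.grp ≤ V'.grp)
    (h : IsArrow g U.grp V.grp) (h' : IsArrow g U.grp V'.grp) (x : M.obj U) :
    M.prPush hV (M.push g hg h x) = M.push g hg h' x := by
  unfold prPush
  rw [M.push_push _ _ (by simpa using hg) _ _ (by simpa using h')]
  exact M.push_eq_of_eq (mul_one g) _ _ _ _ x

variable [IsTopologicalGroup G]

theorem hecke_apply {U : LevelGroup S} {g : G} (hg : g⁻¹ ∈ S) (x : M.obj U) :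
    M.hecke g hg U x =
      M.push g hg (U.isArrow_interConj U g) (M.prPull (U.interConj_le U g) x) := rfl

/-- The Hecke operator of `τ` is transported by `[τʳ]_⋆ : M(U) → M(τ⁻ʳ U τʳ)`. -/
theorem hecke_push_pow {U V : LevelGroup S} {τ : G} (hτ : τ⁻¹ ∈ S) (r : ℕ) (hr : (τ ^ r)⁻¹ ∈ S)
    (h : IsArrow (τ ^ r) U.grp V.grp) (hinv : IsArrow (τ ^ r)⁻¹ V.grp U.grp) (x : M.obj U) :
    M.hecke τ hτ V (M.push (τ ^ r) hr h x) = M.push (τ ^ r) hr h (M.hecke τ hτ U x) := by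
  have hc' : τ * τ ^ r = τ ^ r * τ := by rw [← pow_succ, ← pow_succ']
  -- As `τ ^ r` commutes with `τ`, it conjugates `U ∩ τ U τ⁻¹` onto `V ∩ τ V τ⁻¹`.
  have h1 : IsArrow (τ ^ r) (U.interConj U τ).grp (V.interConj V τ).grp := by
    rintro y ⟨hy, hy'⟩
    refine ⟨h y hy, mem_conjSubgroup.2 ?_⟩
    have h2 := h _ (mem_conjSubgroup.1 hy')
    convert h2 using 1
    group
  have h2 : IsArrow (τ ^ r)⁻¹ (V.interConj V τ).grp (U.interConj U τ).grp := by
    rintro y ⟨hy, hy'⟩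
    refine ⟨hinv y hy, mem_conjSubgroup.2 ?_⟩
    have h2 := hinv _ (mem_conjSubgroup.1 hy')
    convert h2 using 1
    group
  have hS : (τ * τ ^ r)⁻¹ ∈ S := by
    rw [mul_inv_rev]
    exact S.mul_mem hr hτ
  rw [hecke_apply, hecke_apply,
    M.prPull_push hr h hinv h1 h2 (U.interConj_le U τ) (V.interConj_le V τ),
    M.push_push _ _ (hc' ▸ hS) _ _ (h1.mul (V.isArrow_interConj V τ)),
    M.push_push _ _ hS _ _ ((U.isArrow_interConj U τ).mul h)]
  exact M.push_eq_of_eq hc'.symm _ _ _ _ _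

end CohomologyFunctor

/-! ### Transitivity of finite pullbacks on Iwasawa completions. -/

section IwPullback

variable [IsTopologicalGroup G] (M : CohomologyFunctor.{v} A S)

/-- Transitivity of the finite pullbacks of Iwasawa completions, for `K₁` cut out in `K` by a
level group. -/
theorem iwPullback_iwPullback (hM : M.IsCartesian) {K K₁ K₂ : Subgroup G} (h₁ : K₁ ≤ K)
    (h₁' : ∃ W : Subgroup G, IsOpen (W : Set G) ∧ W ⊓ K ≤ K₁) (hK : ∃ V₀ : LevelGroup S, K ≤ V₀.grp)
    (h₂ : K₂ ≤ K₁) (h₂' : ∃ W : Subgroup G, IsOpen (W : Set G) ∧ W ⊓ K₁ ≤ K₂)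
    (hK₁ : ∃ V₀ : LevelGroup S, K₁ ≤ V₀.grp)
    (h₃' : ∃ W : Subgroup G, IsOpen (W : Set G) ∧ W ⊓ K ≤ K₂)
    {W₁ : LevelGroup S} (hW₁ : W₁.grp ⊓ K = K₁) (z : M.iw K) :
    iwPullback M hM h₂ h₂' hK₁ (iwPullback M hM h₁ h₁' hK z) =
      iwPullback M hM (h₂.trans h₁) h₃' hK z := by
  have hKW₁ : K₁ ≤ W₁.grp := hW₁.symm.trans_le inf_le_left
  apply Subtype.ext
  funext U'
  obtain ⟨V, V₂, hV, hV₂⟩ := exists_isGoodPair_le (h₂.trans h₁) h₃' hK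
    ⟨U'.1.ofLE (U'.1.grp ⊓ W₁.grp) (U'.1.isOpen.inter W₁.isOpen) inf_le_left,
      le_inf U'.2 (h₂.trans hKW₁)⟩
  -- With `V₂` chosen inside `W₁`, the group `V ∩ W₁` splits the good pair `(V, V₂)` into good pairs
  -- for `K₁ ⊆ K` and `K₂ ⊆ K₁`.
  let V₁ : LevelGroup S := V.ofLE (V.grp ⊓ W₁.grp) (V.isOpen.inter W₁.isOpen) inf_le_left
  have hV₂₁ : V₂.grp ≤ V₁.grp := le_inf hV.le_pair (hV₂.trans inf_le_right)
  have g₁ : IsGoodPair K K₁ V.grp V₁.grp :=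
    { le := hV.le
      le' := le_inf (h₁.trans hV.le) hKW₁
      le_pair := inf_le_left
      inf_le := fun y hy => hW₁.le ⟨hy.1.2, hy.2⟩
      exists_mul := fun v hv => by
        obtain ⟨a, ha, b, hb, e⟩ := hV.exists_mul v hv
        exact ⟨a, hV₂₁ ha, b, hb, e⟩ }
  have g₂ : IsGoodPair K₁ K₂ V₁.grp V₂.grp :=
    { le := le_inf (h₁.trans hV.le) hKW₁
      le' := hV.le'
      le_pair := hV₂₁
      inf_le := fun y hy => hV.inf_le ⟨hy.1, h₁ hy.2⟩
      exists_mul := fun v hv => by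
        obtain ⟨a, ha, b, hb, e⟩ := hV.exists_mul v hv.1
        have hb' : b = a⁻¹ * v := by rw [e, inv_mul_cancel_left]
        exact ⟨a, ha, b, hW₁.le ⟨hb' ▸ W₁.grp.mul_mem (W₁.grp.inv_mem (hV₂₁ ha).2) hv.2, hb⟩, e⟩ }
  have hU : V₂.grp ≤ U'.1.grp := hV₂.trans inf_le_left
  rw [← (iwPullback M hM h₂ h₂' hK₁ (iwPullback M hM h₁ h₁' hK z)).2 ⟨V₂, hV.le'⟩ U' hU,
    ← (iwPullback M hM (h₂.trans h₁) h₃' hK z).2 ⟨V₂, hV.le'⟩ U' hU,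
    iwPullback_apply M hM _ _ _ _ g₂, iwPullback_apply M hM _ _ _ _ g₁,
    iwPullback_apply M hM _ _ _ _ hV, M.prPull_prPull]

end IwPullback

/-! ### Base change for `ι_⋆` when there is only one double coset. -/

section Pushforward

variable [IsTopologicalGroup G] {H : Subgroup G} {hH : IsClosed (H : Set G)}
  {MH : CohomologyFunctor.{v} A (S.comap H.subtype)} {MG : CohomologyFunctor.{v'} A S}

/-- If `V = U (V ∩ H)`, then `ι_⋆` commutes with `pr^⋆`. -/
theorem Pushforward.prPull_map (ι : Pushforward H hH MH MG) {U V : LevelGroup S}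
    (hUV : U.grp ≤ V.grp) (hV : ∀ v ∈ V.grp, ∃ a ∈ U.grp, ∃ b ∈ V.grp ⊓ H, v = a * b)
    (hUV' : (U.restrict H hH).grp ≤ (V.restrict H hH).grp) (x : MH.obj (V.restrict H hH)) :
    MG.prPull hUV (ι.map V x) = ι.map U (MH.prPull hUV' x) := by
  have hT : IsDoubleCosetReps {(1 : G)} V.grp U.grp (V.grp ⊓ H) := by
    refine ⟨by simp, fun v hv => ⟨1, ⟨by simp, ?_⟩, fun γ hγ => by simpa using hγ.1⟩⟩
    obtain ⟨a, ha, b, hb, rfl⟩ := hV v hv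
    exact ⟨a, ha, b, hb, by simp⟩
  rw [ι.map_pull U V hUV {1} hT x, Fintype.sum_subsingleton _ ⟨1, by simp⟩]
  -- The single summand lives at level `1⁻¹ U 1`; the level is generalised so that it can be
  -- identified with `U`.
  have key : ∀ (U' : LevelGroup S) (hU' : U' = U) (h1 : ((1 : G)⁻¹)⁻¹ ∈ S)
      (h2 : IsArrow (1 : G)⁻¹ U'.grp U.grp) (h3 : (U'.restrict H hH).grp ≤ (V.restrict H hH).grp),
      MG.push (1 : G)⁻¹ h1 h2 (ι.map U' (MH.prPull h3 x)) = ι.map U (MH.prPull hUV' x) := by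
    rintro _ rfl h1 h2 h3
    rw [MG.push_eq_of_eq inv_one h1 (by simp) h2 (isArrow_one le_rfl), MG.push_one]
    rfl
  exact key _ (LevelGroup.ext (by ext y; simp [LevelGroup.ofLE, mem_conjSubgroup])) _ _ _

theorem Pushforward.map_prPush (ι : Pushforward H hH MH MG) {U V : LevelGroup S}
    (hUV : U.grp ≤ V.grp) (hUV' : (U.restrict H hH).grp ≤ (V.restrict H hH).grp)
    (x : MH.obj (U.restrict H hH)) :
    ι.map V (MH.prPush hUV' x) = MG.prPush hUV (ι.map U x) :=
  ι.map_push U V 1 (by simp) (isArrow_one hUV) x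

theorem iwPullback_eq_of_eq {M : CohomologyFunctor.{v} A S} (hM : M.IsCartesian)
    {K K₁ K₂ : Subgroup G} (h : K₁ = K₂)
    (h₁ : K₁ ≤ K) (h₁' : ∃ W : Subgroup G, IsOpen (W : Set G) ∧ W ⊓ K ≤ K₁)
    (h₂ : K₂ ≤ K) (h₂' : ∃ W : Subgroup G, IsOpen (W : Set G) ∧ W ⊓ K ≤ K₂)
    (hK : ∃ V₀ : LevelGroup S, K ≤ V₀.grp) (z : M.iw K)
    (U : LevelGroup S) (hU₁ : K₁ ≤ U.grp) (hU₂ : K₂ ≤ U.grp) :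
    (iwPullback M hM h₁ h₁' hK z).1 ⟨U, hU₁⟩ = (iwPullback M hM h₂ h₂' hK z).1 ⟨U, hU₂⟩ := by
  subst h
  rfl

/-- For levels `W₁ ⊆ W' ⊆ W` with `W = W' (W ∩ K)` and `W' ∩ K = W₁ ∩ K`, the pullback to `W'` of
the component at `W` of the finite pullback of `z` is the pushforward of its component at `W₁`. -/
theorem prPull_component_eq_prPush {M : CohomologyFunctor.{v} A S} (hM : M.IsCartesian)
    {K : Subgroup G} (hK : ∃ V₀ : LevelGroup S, K ≤ V₀.grp) {W W' W₁ : LevelGroup S}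
    (hW' : W'.grp ≤ W.grp) (hW₁ : W₁.grp ≤ W'.grp)
    (hmul : ∀ v ∈ W.grp, ∃ a ∈ W'.grp, ∃ b ∈ K ⊓ W.grp, v = a * b)
    (hinf : K ⊓ W'.grp ≤ W₁.grp) (z : M.iw K)
    (h : ∃ X : Subgroup G, IsOpen (X : Set G) ∧ X ⊓ K ≤ K ⊓ W.grp)
    (h₁ : ∃ X : Subgroup G, IsOpen (X : Set G) ∧ X ⊓ K ≤ K ⊓ W₁.grp) :
    M.prPull hW' ((iwPullback M hM inf_le_left h hK z).1 ⟨W, inf_le_right⟩) =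
      M.prPush hW₁ ((iwPullback M hM inf_le_left h₁ hK z).1 ⟨W₁, inf_le_right⟩) := by
  have hle : K ⊓ W'.grp ≤ K ⊓ W.grp := inf_le_inf_left _ hW'
  have hgood : IsGoodPair (K ⊓ W.grp) (K ⊓ W'.grp) W.grp W'.grp :=
    ⟨inf_le_right, inf_le_right, hW', fun y hy => ⟨hy.2.1, hy.1⟩, hmul⟩
  -- Thus the completion reached by pulling back to `K ∩ W'` is the one at `K ∩ W₁`. It has a
  -- component at the smaller level `W₁`, which pushes forward to the one at `W'`.
  have hK₁ : K ⊓ W'.grp = K ⊓ W₁.grp :=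
    le_antisymm (le_inf inf_le_left hinf) (inf_le_inf_left _ hW₁)
  rw [(iwPullback M hM inf_le_left h₁ hK z).2 ⟨W₁, inf_le_right⟩
      ⟨W', inf_le_right.trans hW₁⟩ hW₁,
    ← iwPullback_apply M hM hle ⟨W'.grp, W'.isOpen, fun y hy => ⟨hy.2.1, hy.1⟩⟩
      ⟨W, inf_le_right⟩ _ hgood,
    iwPullback_iwPullback M hM _ _ _ hle _ _
      ⟨W'.grp, W'.isOpen, by rw [inf_comm]⟩ (W₁ := W) (inf_comm _ _)]
  exact iwPullback_eq_of_eq hM hK₁ _ _ _ _ _ _ _ _ _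

/-- The version of `prPull_component_eq_prPush` for the images under a pushforward map. -/
theorem Pushforward.prPull_map_iwPullback (ι : Pushforward H hH MH MG) (hMH : MH.IsCartesian)
    {K : Subgroup H} (hK : ∃ V₀ : LevelGroup (S.comap H.subtype), K ≤ V₀.grp)
    {W W' W₁ : LevelGroup S} (hW' : W'.grp ≤ W.grp) (hW₁ : W₁.grp ≤ W'.grp)
    (hmul : ∀ v ∈ W.grp, ∃ a ∈ W'.grp, ∃ b ∈ K, (b : G) ∈ W.grp ∧ v = a * b)
    (hinf : ∀ h ∈ K, (h : G) ∈ W'.grp → (h : G) ∈ W₁.grp) (z : MH.iw K)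
    (h : ∃ X : Subgroup H, IsOpen (X : Set H) ∧ X ⊓ K ≤ K ⊓ (W.restrict H hH).grp)
    (h₁ : ∃ X : Subgroup H, IsOpen (X : Set H) ∧ X ⊓ K ≤ K ⊓ (W₁.restrict H hH).grp) :
    MG.prPull hW' (ι.map W
        ((iwPullback MH hMH inf_le_left h hK z).1 ⟨W.restrict H hH, inf_le_right⟩)) =
      MG.prPush hW₁ (ι.map W₁
        ((iwPullback MH hMH inf_le_left h₁ hK z).1 ⟨W₁.restrict H hH, inf_le_right⟩)) := by
  have hWH' : (W'.restrict H hH).grp ≤ (W.restrict H hH).grp := fun y hy => hW' hy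
  have hWH₁ : (W₁.restrict H hH).grp ≤ (W'.restrict H hH).grp := fun y hy => hW₁ hy
  rw [ι.prPull_map hW' _ hWH', prPull_component_eq_prPush hMH hK hWH' hWH₁ _
    (fun y hy => hinf y hy.1 hy.2) z h h₁, ι.map_prPush hW₁ hWH₁]
  · intro v hv
    obtain ⟨a, ha, b, hb, hbW, e⟩ := hmul v hv
    -- The factor `a` was only known in `G`; it lies in `H` because `v` and `b` do.
    have ha' : a = (v * b⁻¹ : H) := by rw [Subgroup.coe_mul, Subgroup.coe_inv, e]; group
    exact ⟨v * b⁻¹, show ((v * b⁻¹ : H) : G) ∈ W'.grp from ha' ▸ ha, b, ⟨hb, hbW⟩, by group⟩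
  · intro v hv
    obtain ⟨a, ha, b, -, hbW, e⟩ := hmul v hv
    exact ⟨a, ha, b, ⟨hbW, b.2⟩, e⟩

end Pushforward

end Formalism

/-! ### Comparison of the classes at levels `r` and `r + 1`. -/

namespace GroupDatum

variable {p : ℕ} [Fact p.Prime] {D : GroupDatum p} {S : Submonoid D.GQp}
  {A : Type w} [CommRing A] {MH : CohomologyFunctor.{v} A (S.comap D.HQp.subtype)}
  {MG : CohomologyFunctor.{v'} A S}

theorem mem_conjSubgroup_u_inv {U : Subgroup D.GQp} {x : D.GQp} :
    x ∈ conjSubgroup (inclQp D.u)⁻¹ U ↔ (inclQp D.u)⁻¹ * x * inclQp D.u ∈ U := by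
  rw [mem_conjSubgroup, inv_inv]

theorem conjSubgroup_mono {G : Type*} [Group G] (g : G) {U V : Subgroup G} (h : U ≤ V) :
    conjSubgroup g U ≤ conjSubgroup g V := Subgroup.comap_mono h

theorem inclQp_mem_HQp {q : Points ℤ_[p] D.R ℤ_[p]} (hq : q ∈ closedSubgroup D.idealQ ℤ_[p]) :
    inclQp q ∈ D.HQp := fun f hf =>
  Points.map_mem_closedSubgroup (Algebra.ofId ℤ_[p] ℚ_[p]) D.idealQ hq f (D.le_Q hf)

theorem mem_QZp_iff {h : D.HQp} :
    h ∈ D.QZp ↔ ∃ q ∈ closedSubgroup D.idealQ ℤ_[p], inclQp q = h := Iff.rfl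

/-- Under condition (A), `u U_r u⁻¹` is the product of its subgroup `u (U_r ∩ τ U_r τ⁻¹) u⁻¹` and
its intersection with `Q_H⁰(ℤ_p)`. -/
theorem exists_mul_conj_of_conditionA (hA : D.ConditionA) {r : ℕ} (hr : 1 ≤ r) {x : D.GQp}
    (hx : x ∈ conjSubgroup (inclQp D.u)⁻¹ (D.Ugrp r)) :
    ∃ a ∈ conjSubgroup (inclQp D.u)⁻¹ (D.Ugrp r ⊓ conjSubgroup D.tau⁻¹ (D.Ugrp r)),
      ∃ b ∈ D.QZp, (b : D.GQp) ∈ conjSubgroup (inclQp D.u)⁻¹ (D.Ugrp r) ∧ x = a * b := by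
  obtain ⟨a, ha, q, hq, h⟩ := exists_mul_of_conditionA hA hr (mem_conjSubgroup_u_inv.1 hx)
  rw [map_mul, map_mul, map_inv] at h
  have ha' : inclQp D.u * a * (inclQp D.u)⁻¹ ∈
      conjSubgroup (inclQp D.u)⁻¹ (D.Ugrp r ⊓ conjSubgroup D.tau⁻¹ (D.Ugrp r)) := by
    rw [mem_conjSubgroup_u_inv]
    convert ha using 1
    group
  have hxq : x = inclQp D.u * a * (inclQp D.u)⁻¹ * inclQp q := by
    have h1 : x = inclQp D.u * ((inclQp D.u)⁻¹ * x * inclQp D.u) * (inclQp D.u)⁻¹ := by group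
    rw [h1, h]
    group
  have hqW : inclQp q ∈ conjSubgroup (inclQp D.u)⁻¹ (D.Ugrp r) := by
    have h1 : inclQp q = (inclQp D.u * a * (inclQp D.u)⁻¹)⁻¹ * x := by
      rw [hxq]
      group
    rw [h1]
    exact Subgroup.mul_mem _ (Subgroup.inv_mem _ (conjSubgroup_mono _ inf_le_left ha')) hx
  exact ⟨_, ha', ⟨inclQp q, inclQp_mem_HQp hq⟩, ⟨q, hq, rfl⟩, hqW, hxq⟩

/-- Under condition (B), the groups `u (U_r ∩ τ U_r τ⁻¹) u⁻¹` and `u U_{r+1} u⁻¹` have the same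
intersection with `Q_H⁰(ℤ_p)`. -/
theorem mem_conj_Ugrp_succ_of_conditionB (hB : D.ConditionB) {r : ℕ} {h : D.HQp} (hh : h ∈ D.QZp)
    (hx : (h : D.GQp) ∈
      conjSubgroup (inclQp D.u)⁻¹ (D.Ugrp r ⊓ conjSubgroup D.tau⁻¹ (D.Ugrp r))) :
    (h : D.GQp) ∈ conjSubgroup (inclQp D.u)⁻¹ (D.Ugrp (r + 1)) := by
  obtain ⟨q, hq, hqh⟩ := mem_QZp_iff.1 hh
  rw [mem_conjSubgroup_u_inv, ← hqh, ← map_inv, ← map_mul, ← map_mul] at hx ⊢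
  exact mem_Ugrp_succ_of_conditionB hB hq hx

/-- The heart of the argument. After conjugation by `u`, (A) supplies the factorisation through
`Q_H⁰(ℤ_p)` and (B) the equality of intersections with it that `Pushforward.prPull_map_iwPullback`
requires. -/
theorem prPull_zG (hA : D.ConditionA) (hB : D.ConditionB) (hS : ∀ g ∈ D.GZp, g ∈ S)
    (hMH : MH.IsCartesian) (ι : Pushforward D.HQp D.HQp_isClosed MH MG) (zH : MH.iw D.QZp)
    {r : ℕ} (hr : 1 ≤ r) :
    MG.prPull ((D.U hS r).interConj_le (D.U hS r) D.tau) (D.zG hS hMH ι zH r) =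
      MG.prPush (V := (D.U hS r).interConj (D.U hS r) D.tau) (Ugrp_succ_le_inf r)
        (D.zG hS hMH ι zH (r + 1)) := by
  have hu : (inclQp D.u)⁻¹ ∈ S := hS _ (D.GZp.inv_mem ⟨D.u, rfl⟩)
  set U' := (D.U hS r).interConj (D.U hS r) D.tau
  -- the group `u U' u⁻¹`, between `u U_{r+1} u⁻¹` and `u U_r u⁻¹`
  let W' : LevelGroup S := (D.W hS r).ofLE (conjSubgroup (inclQp D.u)⁻¹ U'.grp)
    (conjSubgroup_isOpen _ U'.isOpen)
    (conjSubgroup_mono _ ((D.U hS r).interConj_le (D.U hS r) D.tau))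
  have hW' : W'.grp ≤ (D.W hS r).grp :=
    conjSubgroup_mono _ ((D.U hS r).interConj_le (D.U hS r) D.tau)
  have hW : (D.W hS (r + 1)).grp ≤ W'.grp := conjSubgroup_mono _ (Ugrp_succ_le_inf r)
  have harr : IsArrow (inclQp D.u) W'.grp U'.grp := isArrow_conj_inv_left _ _
  have harr' : IsArrow (inclQp D.u)⁻¹ U'.grp W'.grp := isArrow_conj _ _
  have key := ι.prPull_map_iwPullback hMH ⟨_, D.QZp_le hS⟩ hW' hW
    (fun v hv => exists_mul_conj_of_conditionA hA hr hv)
    (fun h hh hx => mem_conj_Ugrp_succ_of_conditionB hB hh hx) zH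
    ⟨_, ((D.W hS r).restrict D.HQp D.HQp_isClosed).isOpen, by rw [inf_comm]⟩
    ⟨_, ((D.W hS (r + 1)).restrict D.HQp D.HQp_isClosed).isOpen, by rw [inf_comm]⟩
  -- The isomorphism `[u]_⋆` commutes with `pr^⋆`, so the identity at the conjugated levels can be
  -- carried back.
  refine (MG.prPull_push hu _ (isArrow_conj (inclQp D.u)⁻¹ (D.Ugrp r)) harr harr' hW'
    ((D.U hS r).interConj_le (D.U hS r) D.tau) _).trans ?_
  refine (congr_arg _ key).trans ?_
  refine (MG.push_prPush hu hW harr (fun y hy => harr y (hW hy)) _).trans ?_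
  exact (MG.prPush_push hu _ _ _ _).symm

end GroupDatum

end NormRelations

/-! ### The norm relations. -/

theorem mainTheorem3 (p : ℕ) [Fact p.Prime] (D : GroupDatum p)
    (hA : D.ConditionA) (hB : D.ConditionB)
    {A : Type*} [CommRing A] (S : Submonoid D.GQp)
    (hS : ∀ g ∈ D.GZp, g ∈ S) (hτ : D.tau⁻¹ ∈ S)
    (MG : CohomologyFunctor A S) (hMG : MG.IsCartesian)
    (MH : CohomologyFunctor A (S.comap D.HQp.subtype)) (hMH : MH.IsCartesian)
    (ι : Pushforward D.HQp D.HQp_isClosed MH MG) (zH : MH.iw D.QZp) (r : ℕ) (hr : 1 ≤ r) :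
    (∃ h : IsArrow D.tau (D.U hS (r + 1)).grp (D.U hS r).grp,
      MG.push D.tau hτ h (D.zG hS hMH ι zH (r + 1)) =
        MG.hecke D.tau hτ (D.U hS r) (D.zG hS hMH ι zH r)) ∧
    (∃ h : (D.V hS (r + 1)).grp ≤ (D.V hS r).grp,
      MG.prPush h (D.xiG hS hτ hMH ι zH (r + 1)) =
        MG.hecke D.tau hτ (D.V hS r) (D.xiG hS hτ hMH ι zH r)) := by
  have hU : IsArrow D.tau (D.U hS (r + 1)).grp (D.U hS r).grp := GroupDatum.isArrow_tau r
  have hrel : MG.push D.tau hτ hU (D.zG hS hMH ι zH (r + 1)) =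
      MG.hecke D.tau hτ (D.U hS r) (D.zG hS hMH ι zH r) := by
    -- The Hecke operator is `[τ]_⋆ ∘ pr^⋆`; once `pr^⋆ z_{G,r}` becomes `pr_⋆ z_{G,r+1}`, the two
    -- pushforwards compose to `[τ]_⋆`.
    rw [MG.hecke_apply, GroupDatum.prPull_zG hA hB hS hMH ι zH hr]
    exact (MG.push_prPush hτ _ _ _ _).symm
  -- This is the inclusion `τ⁻¹ U_{r+1} τ ⊆ U_r` conjugated by `τ ^ r`.
  have hV : (D.V hS (r + 1)).grp ≤ (D.V hS r).grp := by
    intro x hx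
    have h1 := hU _ (mem_conjSubgroup.1 hx)
    refine mem_conjSubgroup.2 ?_
    convert h1 using 1
    group
  refine ⟨⟨hU, hrel⟩, hV, ?_⟩
  have harr : IsArrow (D.tau ^ r) (D.U hS r).grp (D.V hS r).grp :=
    isArrow_conj (D.tau ^ r) (D.Ugrp r)
  have harr' : IsArrow (D.tau ^ (r + 1)) (D.U hS (r + 1)).grp (D.V hS (r + 1)).grp :=
    isArrow_conj (D.tau ^ (r + 1)) (D.Ugrp (r + 1))
  change MG.prPush hV (MG.push (D.tau ^ (r + 1)) (D.inv_pow_mem hτ (r + 1)) harr' _) =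
    MG.hecke D.tau hτ (D.V hS r) (MG.push (D.tau ^ r) (D.inv_pow_mem hτ r) harr _)
  -- Both sides are `[τ ^ (r+1)]_⋆ z_{G,r+1}`: on the right the Hecke operator moves past `[τʳ]_⋆`,
  -- and the first relation supplies the extra `[τ]_⋆`.
  rw [MG.hecke_push_pow hτ r (D.inv_pow_mem hτ r) harr
      (isArrow_conj_inv (D.tau ^ r) (D.Ugrp r)), ← hrel,
    MG.prPush_push _ hV harr' fun x hx => hV (harr' x hx),
    MG.push_push hτ _ (pow_succ' D.tau r ▸ D.inv_pow_mem hτ (r + 1)) hU harr (hU.mul harr)]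
  exact MG.push_eq_of_eq (pow_succ' D.tau r) _ _ _ _ _
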